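/- There is a universal constant $C>0$ such that the following holds. Let $n,d,k\ge 1$, let $\mu_1,\dots,\mu_n\in\mathbb R^d$ be deterministic vectors whose span $\Gamma$ has dimension $k$, and let $m_1,\dots,m_n\ge 2$ be integers and $\eta_1,\dots,\eta_n\ge 0$. For $i=1,\dots,n$ and $j=1,\dots,m_i$ let $x_{ij}=\mu_i+z_{ij}$, where the $z_{ij}$ are (jointly) independent random vectors in $\mathbb R^d$ with mean zero, not necessarily identically distributed, and $z_{ij}$ is $\eta_i$-sub-Gaussian; here a random vector $y$ is called $b$-sub-Gaussian if $\mathbb E\big[|u^{\mathsf T}y-\mathbb E[u^{\mathsf T}y]|^p\big]^{1/p}\le b\sqrt p$ for every unit vector $u\in\mathbb R^d$ and every real $p\ge 1$. Choose the weights $w_1=\dots=w_n=1/n$, put $$A=\sum_{i=1}^n\frac{w_i}{m_i(m_i-1)}\sum_{j_1\ne j_2}x_{ij_1}x_{ij_2}^{\mathsf T},$$ and let $\hat\Gamma$ be the subspace spanned by the top-$k$ (orthonormal) eigenvectors of $A$, i.e. those belonging to the $k$ largest eigenvalues (ties broken arbitrarily). Let $\theta\in[0,\pi/2]$ be the maximum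 principal angle between $\hat\Gamma$ and $\Gamma$, so that $\sin\theta$ is the spectral norm of the difference of the orthogonal projections onto $\hat\Gamma$ and $\Gamma$. For $1\le\ell\le d$ let $\sigma_\ell\ge 0$ be such that $\sigma_\ell^2$ is the $\ell$-th largest eigenvalue of $\sum_{i=1}^n w_i\mu_i\mu_i^{\mathsf T}$, and let $t=\max_i\eta_i/\sqrt{m_i}$. Then for every $\delta\in(0,1/2)$, with probability at least $1-\delta$, $$\sin\theta\le C\,\frac{t\sigma_1+t^2}{\sigma_k^2}\sqrt{\frac{d+\log(1/\delta)}{n}}.$$ In particular, if $\eta_1=\dots=\eta_n=\eta$ and $m_1=\dots=m_n=m$, then for every $\delta\in(0,1/2)$, with probability at least $1-\delta$, $$\sin\theta\le C\left(\frac{\eta\sigma_1}{\sigma_k^2\sqrt m}+\frac{\eta^2}{\sigma_k^2 m}\right)\sqrt{\frac{d+\log(1/\delta)}{n}}.$$ -/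

import Mathlib

open MeasureTheory ProbabilityTheory

noncomputable section

namespace UserPCA

/-- A real random variable `X` (with an expectation) has sub-Gaussian constant `b`:
`E[|X - E X|^p]^{1/p} ≤ b √p` for every real `p ≥ 1`. The left side is written as the extended
`L^p` seminorm, so the bound includes that the moments are finite. -/
def HasSubGaussianConst {Ω : Type*} [MeasurableSpace Ω] (P : Measure Ω) (X : Ω → ℝ) (b : ℝ) :
    Prop :=
  Integrable X P ∧ ∀ p : ℝ, 1 ≤ p →
    eLpNorm (fun ω => X ω - ∫ ω', X ω' ∂P) (ENNReal.ofReal p) P ≤ ENNReal.ofReal (b * √p)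

/-- A random vector is `b`-sub-Gaussian: all its one-dimensional marginals along unit vectors have
sub-Gaussian constant `b`. -/
def IsSubGaussianVector {Ω : Type*} [MeasurableSpace Ω] {d : ℕ} (P : Measure Ω)
    (y : Ω → EuclideanSpace ℝ (Fin d)) (b : ℝ) : Prop :=
  ∀ u : EuclideanSpace ℝ (Fin d), ‖u‖ = 1 → HasSubGaussianConst P (fun ω => inner ℝ u (y ω)) b

/-- The rank one matrix `x yᵀ`. -/
def outer {d : ℕ} (x y : EuclideanSpace ℝ (Fin d)) : Matrix (Fin d) (Fin d) ℝ :=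
  Matrix.of fun a b => x a * y b

/-- The weighted second moment matrix `∑ i, wᵢ μᵢ μᵢᵀ` of the user-specific means. -/
def meanMatrix {n d : ℕ} (w : Fin n → ℝ) (μ : Fin n → EuclideanSpace ℝ (Fin d)) :
    Matrix (Fin d) (Fin d) ℝ :=
  ∑ i, w i • outer (μ i) (μ i)

theorem meanMatrix_isHermitian {n d : ℕ} (w : Fin n → ℝ)
    (μ : Fin n → EuclideanSpace ℝ (Fin d)) : (meanMatrix w μ).IsHermitian := by
  ext a b
  simp [meanMatrix, outer, Matrix.sum_apply, mul_comm]

/-- `σ_ℓ`, for `1 ≤ ℓ ≤ d`: the nonnegative square root of the `ℓ`-th largest eigenvalue (with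
multiplicity) of `∑ i, wᵢ μᵢ μᵢᵀ`; by convention `0` for other `ℓ`. Mathlib's `eigenvalues₀` is the
list of all eigenvalues in decreasing order, indexed from zero. -/
def sigma {n d : ℕ} (w : Fin n → ℝ) (μ : Fin n → EuclideanSpace ℝ (Fin d)) (ℓ : ℕ) : ℝ :=
  if h : 1 ≤ ℓ ∧ ℓ ≤ d then
    √((meanMatrix_isHermitian w μ).eigenvalues₀
      ⟨ℓ - 1, by rw [Fintype.card_fin]; omega⟩)
  else 0

/-- The matrix `A = ∑ i, wᵢ / (mᵢ (mᵢ - 1)) ∑_{j₁ ≠ j₂} x_{i j₁} x_{i j₂}ᵀ`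
computed from the data. -/
def estimatorMatrix {n d : ℕ} (w : Fin n → ℝ) (m : Fin n → ℕ)
    (x : (i : Fin n) → Fin (m i) → EuclideanSpace ℝ (Fin d)) : Matrix (Fin d) (Fin d) ℝ :=
  ∑ i, (w i / ((m i : ℝ) * ((m i : ℝ) - 1))) •
    ∑ j₁ : Fin (m i), ∑ j₂ : Fin (m i), if j₁ ≠ j₂ then outer (x i j₁) (x i j₂) else 0

/-- `V` is a subspace spanned by top-`k` eigenvectors of the (symmetric) matrix `A`: it is the span
of the first `k` vectors of an orthonormal eigenbasis ordered by decreasing eigenvalue. (It is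
unique unless the `k`-th and the `(k+1)`-st largest eigenvalues coincide.) -/
def IsTopEigenspace {d : ℕ} (A : Matrix (Fin d) (Fin d) ℝ) (k : ℕ)
    (V : Submodule ℝ (EuclideanSpace ℝ (Fin d))) : Prop :=
  ∃ (b : OrthonormalBasis (Fin d) ℝ (EuclideanSpace ℝ (Fin d))) (ev : Fin d → ℝ),
    Antitone ev ∧ (∀ i, Matrix.toEuclideanLin A (b i) = ev i • b i) ∧
      V = Submodule.span ℝ {v | ∃ i : Fin d, (i : ℕ) < k ∧ v = b i}

/-- The maximum principal angle between two subspaces of equal dimension: the `θ ∈ [0, π/2]` whose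
sine is the spectral norm of the difference of the two orthogonal projections. -/
def maxPrincipalAngle {d : ℕ} (V W : Submodule ℝ (EuclideanSpace ℝ (Fin d))) : ℝ :=
  Real.arcsin ‖V.starProjection - W.starProjection‖

/-- The property `Q` holds with probability at least `p`: it holds on a measurable event of
probability at least `p`. -/
def WithProbAtLeast {Ω : Type*} [MeasurableSpace Ω] (P : Measure Ω) (p : ℝ) (Q : Ω → Prop) :
    Prop :=
  ∃ E : Set Ω, MeasurableSet E ∧ ENNReal.ofReal p ≤ P E ∧ ∀ ω ∈ E, Q ω

end UserPCA

end

/-! Write `M` for `meanMatrix w μ`. Dropping the diagonal pairs makes `A` an unbiased estimator of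
`M`, whose range is Γ and whose smallest nonzero eigenvalue is `σ_k²`. Hence it suffices to bound `A
- M` in operator norm and to apply a Davis–Kahan argument.

In a unit direction `u`, put `c i = ⟪u, μ i⟫` and `a i j = ⟪u, z i j⟫`. The quadratic form of `A -
M` is the average over `i` of a linear term `∑ j, (2 c i / m i) a i j` and a centred degree two
U-statistic of the noise (`uStat_const_add`). The linear part is sub-Gaussian, with variance proxy
controlled by `∑ c i ² ≤ n σ₁²`, and contributes `t σ₁ s`, where `s² = (d + log (1/δ)) / n`. The
U-statistics are sub-exponential at scale `η i ² / m i ≤ t²` (`uStat_factorialMoments`), so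
Bernstein's inequality contributes `t² (s + s²)`. A union bound over a `1/2`-net of `5 ^ d`
directions turns this into an operator norm bound (`direction_tail`, `norm_apply_le_of_half_net`,
`estimator_concentration`).

The perturbation theorem `norm_starProjection_sub_le` then divides by `σ_k²`. The surplus `t² s²` is
at most `t σ₁ s` when `t s < σ₁`; otherwise the claimed bound exceeds 1 and is trivial. -/

/-! ### Factorial moments, sub-exponential and sub-Gaussian generating functions -/

section Scalar

open Real
open scoped Nat NNReal ENNReal

namespace UserPCA

variable {Ω : Type*} [MeasurableSpace Ω] {P : Measure Ω}

/-- Factorial moment growth: `E |X|^q ≤ q! K^q` for all `q`, which characterizes sub-exponential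
random variables up to constants. -/
structure FactorialMoments (P : Measure Ω) (X : Ω → ℝ) (K : ℝ) : Prop where
  nonneg : 0 ≤ K
  integrable : ∀ q : ℕ, Integrable (fun ω => |X ω| ^ q) P
  le : ∀ q : ℕ, ∫ ω, |X ω| ^ q ∂P ≤ q.factorial * K ^ q

theorem FactorialMoments.mono {X : Ω → ℝ} {K K' : ℝ} (h : FactorialMoments P X K) (hK : K ≤ K') :
    FactorialMoments P X K' :=
  ⟨h.nonneg.trans hK, h.integrable, fun q => (h.le q).trans (by
    have := h.nonneg
    gcongr)⟩

/-- The `q`-th term of the exponential series has `L¹` norm at most `(|l| K) ^ q`, so a geometric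
series justifies exchanging sum and integral. -/
theorem FactorialMoments.hasSum_integral_exp {X : Ω → ℝ} {K : ℝ} (h : FactorialMoments P X K)
    (hX : AEStronglyMeasurable X P) {l : ℝ} (hl : |l| * K < 1) :
    Integrable (fun ω => exp (l * X ω)) P ∧
      HasSum (fun q : ℕ => l ^ q / q.factorial * ∫ ω, X ω ^ q ∂P) (∫ ω, exp (l * X ω) ∂P) := by
  have hint : ∀ q : ℕ, Integrable (fun ω => (l * X ω) ^ q / q.factorial) P := fun q => by
    have h1 : Integrable (fun ω => X ω ^ q) P :=
      (h.integrable q).mono' (hX.pow q) (by simp)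
    simp_rw [mul_pow]
    exact (h1.const_mul _).div_const _
  have hn : ∀ q : ℕ, ∫ ω, ‖(l * X ω) ^ q / q.factorial‖ ∂P ≤ (|l| * K) ^ q := fun q => by
    have : ∀ ω, ‖(l * X ω) ^ q / q.factorial‖ = |l| ^ q / q.factorial * |X ω| ^ q := fun ω => by
      simp [mul_pow]; ring
    simp_rw [this]
    rw [integral_const_mul, mul_pow]
    have hq : (0 : ℝ) < q.factorial := by positivity
    calc |l| ^ q / q.factorial * ∫ ω, |X ω| ^ q ∂P ≤ |l| ^ q / q.factorial * (q.factorial * K ^ q) := by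
          gcongr
          exact h.le q
      _ = |l| ^ q * K ^ q := by field_simp
  have hgeo : Summable fun q : ℕ => (|l| * K) ^ q :=
    summable_geometric_of_lt_one (mul_nonneg (abs_nonneg _) h.nonneg) hl
  have hsum : Summable fun q : ℕ => ∫ ω, ‖(l * X ω) ^ q / q.factorial‖ ∂P :=
    hgeo.of_nonneg_of_le (fun q => integral_nonneg fun ω => norm_nonneg _) hn
  have hexp : ∀ ω, ∑' q : ℕ, (l * X ω) ^ q / q.factorial = exp (l * X ω) := fun ω => by
    rw [Real.exp_eq_exp_ℝ, NormedSpace.exp_eq_tsum_div]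
  have hs := hasSum_integral_of_summable_integral_norm hint hsum
  have hfin : ∑' q : ℕ, ENNReal.ofReal (∫ ω, ‖(l * X ω) ^ q / q.factorial‖ ∂P) ≠ ∞ := by
    rw [← ENNReal.ofReal_tsum_of_nonneg (fun q => integral_nonneg fun ω => norm_nonneg _) hsum]
    exact ENNReal.ofReal_ne_top
  have hi : Integrable (fun ω => exp (l * X ω)) P := by
    refine ⟨(Real.continuous_exp.comp_aestronglyMeasurable (hX.const_mul l)), ?_⟩
    refine lt_of_le_of_lt ?_ hfin.lt_top
    calc ∫⁻ ω, ‖exp (l * X ω)‖ₑ ∂P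
        ≤ ∫⁻ ω, ∑' q : ℕ, ‖(l * X ω) ^ q / q.factorial‖ₑ ∂P := by
          refine lintegral_mono fun ω => ?_
          rw [← hexp ω]
          exact enorm_tsum_le_tsum_enorm
      _ = ∑' q : ℕ, ∫⁻ ω, ‖(l * X ω) ^ q / q.factorial‖ₑ ∂P :=
          lintegral_tsum fun q => (hint q).1.enorm
      _ = _ := by
          congr 1 with q
          rw [ofReal_integral_norm_eq_lintegral_enorm (hint q)]
  refine ⟨hi, ?_⟩
  simp_rw [hexp] at hs
  convert! hs using 2 with q
  rw [← integral_const_mul]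
  congr 1 with ω
  rw [mul_pow]; ring

/-- Bernstein-type bound on the moment generating function. -/
theorem FactorialMoments.mgf_le [IsProbabilityMeasure P] {X : Ω → ℝ} {K : ℝ}
    (h : FactorialMoments P X K) (hX : AEStronglyMeasurable X P) (h0 : ∫ ω, X ω ∂P = 0) {l : ℝ}
    (hl : |l| * K ≤ 1 / 2) :
    mgf X P l ≤ exp (2 * (|l| * K) ^ 2) := by
  obtain ⟨-, hs⟩ := h.hasSum_integral_exp hX (lt_of_le_of_lt hl (by norm_num))
  set r := |l| * K with hr
  have hr0 : 0 ≤ r := mul_nonneg (abs_nonneg _) h.nonneg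
  have hs2 := (hasSum_nat_add_iff' 2).2 hs
  have hg := (hasSum_geometric_of_lt_one hr0 (lt_of_le_of_lt hl (by norm_num))).mul_left (r ^ 2)
  have hle : ∀ q : ℕ, l ^ (q + 2) / (q + 2).factorial * ∫ ω, X ω ^ (q + 2) ∂P ≤ r ^ 2 * r ^ q := by
    intro q
    have hq : (0 : ℝ) < (q + 2).factorial := by positivity
    calc _ ≤ |l ^ (q + 2) / (q + 2).factorial * ∫ ω, X ω ^ (q + 2) ∂P| := le_abs_self _
      _ = |l| ^ (q + 2) / (q + 2).factorial * |∫ ω, X ω ^ (q + 2) ∂P| := by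
          rw [abs_mul, abs_div, abs_pow, abs_of_pos hq]
      _ ≤ |l| ^ (q + 2) / (q + 2).factorial * ((q + 2).factorial * K ^ (q + 2)) := by
          gcongr
          refine (abs_integral_le_integral_abs).trans ?_
          simp_rw [abs_pow]
          exact h.le _
      _ = _ := by rw [hr]; field_simp; ring
  have hfin := hasSum_le hle hs2 hg
  simp only [Finset.sum_range_succ, Finset.sum_range_zero, pow_zero, pow_one, h0, integral_const,
    Nat.factorial] at hfin
  simp only [probReal_univ, smul_eq_mul] at hfin
  have h2 : (1 - r)⁻¹ ≤ 2 := by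
    rw [inv_le_comm₀ (by linarith) (by norm_num)]; linarith
  have h3 : r ^ 2 * (1 - r)⁻¹ ≤ 2 * r ^ 2 := by nlinarith [sq_nonneg r]
  have h4 := Real.add_one_le_exp (2 * r ^ 2)
  have : mgf X P l = ∫ ω, exp (l * X ω) ∂P := rfl
  rw [this]
  norm_num at hfin
  linarith

/-- Version without centring: the first-order term survives, so the exponent is linear in `|l| K`.
It is applied to squares. -/
theorem FactorialMoments.mgf_le_exp [IsProbabilityMeasure P] {X : Ω → ℝ} {K : ℝ}
    (h : FactorialMoments P X K) (hX : AEStronglyMeasurable X P) {l : ℝ}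
    (hl : |l| * K ≤ 1 / 2) :
    mgf X P l ≤ exp (2 * (|l| * K)) := by
  obtain ⟨-, hs⟩ := h.hasSum_integral_exp hX (lt_of_le_of_lt hl (by norm_num))
  set r := |l| * K with hr
  have hr0 : 0 ≤ r := mul_nonneg (abs_nonneg _) h.nonneg
  have hg := (hasSum_geometric_of_lt_one hr0 (lt_of_le_of_lt hl (by norm_num)))
  have hle : ∀ q : ℕ, l ^ q / q.factorial * ∫ ω, X ω ^ q ∂P ≤ r ^ q := by
    intro q
    have hq : (0 : ℝ) < q.factorial := by positivity
    calc _ ≤ |l ^ q / q.factorial * ∫ ω, X ω ^ q ∂P| := le_abs_self _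
      _ = |l| ^ q / q.factorial * |∫ ω, X ω ^ q ∂P| := by
          rw [abs_mul, abs_div, abs_pow, abs_of_pos hq]
      _ ≤ |l| ^ q / q.factorial * (q.factorial * K ^ q) := by
          gcongr
          refine (abs_integral_le_integral_abs).trans ?_
          simp_rw [abs_pow]
          exact h.le _
      _ = _ := by rw [hr, mul_pow]; field_simp
  have hfin := hasSum_le hle hs hg
  have h2 : (1 - r)⁻¹ ≤ 1 + 2 * r := by
    rw [inv_le_iff_one_le_mul₀ (by linarith)]; nlinarith
  have h4 := Real.add_one_le_exp (2 * r)
  have : mgf X P l = ∫ ω, exp (l * X ω) ∂P := rfl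
  rw [this]
  linarith

theorem exp_le_add_exp_sq (x : ℝ) : exp x ≤ x + exp (x ^ 2) := by
  have h1 := Real.add_one_le_exp (x ^ 2)
  rcases le_or_gt |x| 1 with h | h
  · have := (abs_le.1 (Real.abs_exp_sub_one_sub_id_le h)).2
    linarith
  · rcases lt_abs.1 h with h | h
    · have : exp x ≤ exp (x ^ 2) := by gcongr; nlinarith
      linarith
    · have : exp x ≤ 1 := Real.exp_le_one_iff.2 (by linarith)
      nlinarith

/-- A centred random variable whose square has factorial moments is sub-Gaussian. -/
theorem FactorialMoments.hasSubgaussianMGF [IsProbabilityMeasure P] {X : Ω → ℝ} {K : ℝ≥0}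
    (h : FactorialMoments P (fun ω => X ω ^ 2) K) (hX : Integrable X P) (h0 : ∫ ω, X ω ∂P = 0) :
    HasSubgaussianMGF X (5 * K) P := by
  have hXm : AEStronglyMeasurable (fun ω => X ω ^ 2) P := hX.1.pow 2
  have key : ∀ l : ℝ, Integrable (fun ω => exp (l * X ω)) P ∧
      mgf X P l ≤ exp ((5 * K : ℝ≥0) * l ^ 2 / 2) := by
    intro l
    have hK : (0 : ℝ) ≤ K := K.2
    have hmeas : AEStronglyMeasurable (fun ω => exp (l * X ω)) P :=
      Real.continuous_exp.comp_aestronglyMeasurable (hX.1.const_mul l)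
    push_cast
    -- For small `l`, the linear term of `exp x ≤ x + exp (x ^ 2)` integrates to zero and leaves
    -- exponent `2 l² K`. For large `l`, `l X ≤ l² K / 2 + X² / (2K)` gives exponent `l² K / 2 + 1`,
    -- and `1 < 2 l² K`; this is the origin of the factor 5.
    by_cases hl : l ^ 2 * K ≤ 1 / 2
    · have hl' : |l ^ 2| * (K : ℝ) ≤ 1 / 2 := by rwa [abs_of_nonneg (sq_nonneg l)]
      obtain ⟨hi, -⟩ := h.hasSum_integral_exp hXm (lt_of_le_of_lt hl' (by norm_num))
      have hb := h.mgf_le_exp hXm hl'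
      have hle : ∀ ω, exp (l * X ω) ≤ l * X ω + exp (l ^ 2 * X ω ^ 2) := fun ω => by
        rw [← mul_pow]; exact exp_le_add_exp_sq _
      have hi2 : Integrable (fun ω => l * X ω + exp (l ^ 2 * X ω ^ 2)) P :=
        (hX.const_mul l).add hi
      refine ⟨hi2.mono' hmeas (.of_forall fun ω => ?_), ?_⟩
      · rw [Real.norm_eq_abs, abs_of_pos (exp_pos _)]; exact hle ω
      · have hi1 : Integrable (fun ω => exp (l * X ω)) P :=
          hi2.mono' hmeas (.of_forall fun ω => by
            rw [Real.norm_eq_abs, abs_of_pos (exp_pos _)]; exact hle ω)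
        calc mgf X P l ≤ ∫ ω, (l * X ω + exp (l ^ 2 * X ω ^ 2)) ∂P :=
              integral_mono hi1 hi2 hle
          _ = ∫ ω, exp (l ^ 2 * X ω ^ 2) ∂P := by
              rw [integral_add (hX.const_mul l) hi, integral_const_mul, h0]; simp
          _ ≤ exp (2 * (|l ^ 2| * K)) := hb
          _ ≤ _ := by
              rw [abs_of_nonneg (sq_nonneg l)]
              gcongr
              nlinarith [mul_nonneg hK (sq_nonneg l)]
    · push Not at hl
      have hK0 : (0 : ℝ) < K := by
        rcases hK.eq_or_lt with h' | h'
        · rw [← h'] at hl; norm_num at hl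
        · exact h'
      have hl' : |1 / (2 * (K : ℝ))| * (K : ℝ) ≤ 1 / 2 := by
        rw [abs_of_pos (by positivity)]; apply le_of_eq; field_simp
      obtain ⟨hi, -⟩ := h.hasSum_integral_exp hXm (lt_of_le_of_lt hl' (by norm_num))
      have hb := h.mgf_le_exp hXm hl'
      have hle : ∀ ω, exp (l * X ω) ≤
          exp (l ^ 2 * K / 2) * exp (1 / (2 * (K : ℝ)) * X ω ^ 2) := fun ω => by
        rw [← exp_add]
        gcongr
        have : l ^ 2 * K / 2 + 1 / (2 * (K : ℝ)) * X ω ^ 2 - l * X ω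
          = (l * K - X ω) ^ 2 / (2 * K) := by field_simp; ring
        have h2 : 0 ≤ (l * K - X ω) ^ 2 / (2 * K) := by positivity
        linarith
      have hi2 := hi.const_mul (exp (l ^ 2 * K / 2))
      have hi1 : Integrable (fun ω => exp (l * X ω)) P :=
        hi2.mono' hmeas (.of_forall fun ω => by
          rw [Real.norm_eq_abs, abs_of_pos (exp_pos _)]; exact hle ω)
      refine ⟨hi1, ?_⟩
      calc mgf X P l ≤ ∫ ω, exp (l ^ 2 * K / 2) * exp (1 / (2 * (K : ℝ)) * X ω ^ 2) ∂P :=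
            integral_mono hi1 hi2 hle
        _ ≤ exp (l ^ 2 * K / 2) * exp (2 * (|1 / (2 * (K : ℝ))| * K)) := by
            rw [integral_const_mul]
            gcongr
            exact hb
        _ ≤ _ := by
            rw [← exp_add]
            gcongr
            nlinarith
  exact ⟨fun l => (key l).1, fun l => (key l).2⟩

theorem pow_self_le_exp_mul_factorial (q : ℕ) : (q : ℝ) ^ q ≤ exp q * q.factorial := by
  have h := Real.pow_div_factorial_le_exp (x := (q : ℝ)) (by positivity) q
  rwa [div_le_iff₀ (by positivity)] at h

/-- The moment bound at `p = 2q` gives `b ^ (2q) (2q) ^ q`, and `q ^ q ≤ e ^ q q!`. -/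
theorem HasSubGaussianConst.factorialMoments_sq [IsProbabilityMeasure P] {X : Ω → ℝ} {b : ℝ}
    (hb : 0 ≤ b) (h : HasSubGaussianConst P X b) (h0 : ∫ ω, X ω ∂P = 0) :
    FactorialMoments P (fun ω => X ω ^ 2) (2 * exp 1 * b ^ 2) := by
  have hmom : ∀ q : ℕ, Integrable (fun ω => |X ω ^ 2| ^ q) P ∧
      ∫ ω, |X ω ^ 2| ^ q ∂P ≤ q.factorial * (2 * exp 1 * b ^ 2) ^ q := by
    intro q
    rcases Nat.eq_zero_or_pos q with rfl | hq
    · simp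
    have hp : (1 : ℝ) ≤ ((2 * q : ℕ) : ℝ) := by exact_mod_cast (by omega : 1 ≤ 2 * q)
    have h1 := h.2 _ hp
    simp only [h0, sub_zero] at h1
    rw [ENNReal.ofReal_natCast] at h1
    have hX : MemLp X ((2 * q : ℕ) : ℝ≥0∞) P := ⟨h.1.1, lt_of_le_of_lt h1 ENNReal.ofReal_lt_top⟩
    have hne : (2 * q : ℕ) ≠ 0 := by omega
    have hi := hX.integrable_norm_pow hne
    have heq : ∀ ω, |X ω ^ 2| ^ q = ‖X ω‖ ^ (2 * q) := fun ω => by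
      rw [abs_pow, ← pow_mul, Real.norm_eq_abs]
    simp_rw [heq]
    refine ⟨hi, ?_⟩
    rw [hX.eLpNorm_eq_integral_rpow_norm (by exact_mod_cast hne) (ENNReal.natCast_ne_top _)] at h1
    have h2 := (ENNReal.ofReal_le_ofReal_iff (by positivity)).1 h1
    simp only [ENNReal.toReal_natCast, Real.rpow_natCast] at h2
    set I := ∫ ω, ‖X ω‖ ^ (2 * q) ∂P with hI
    have hI0 : 0 ≤ I := integral_nonneg fun ω => by positivity
    have h3 : I ≤ (b * √((2 * q : ℕ) : ℝ)) ^ (2 * q) := by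
      calc I = (I ^ ((2 * q : ℕ) : ℝ)⁻¹) ^ (2 * q) := (Real.rpow_inv_natCast_pow hI0 hne).symm
        _ ≤ _ := by gcongr
    refine h3.trans ?_
    rw [pow_mul, mul_pow, Real.sq_sqrt (by positivity)]
    have h4 := pow_self_le_exp_mul_factorial q
    have h5 : exp (q : ℝ) = exp 1 ^ q := by rw [← exp_nat_mul]; simp
    rw [h5] at h4
    calc (b ^ 2 * ((2 * q : ℕ) : ℝ)) ^ q = (2 * b ^ 2) ^ q * (q : ℝ) ^ q := by
          push_cast; rw [← mul_pow]; ring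
      _ ≤ (2 * b ^ 2) ^ q * (exp 1 ^ q * q.factorial) := by gcongr
      _ = _ := by simp only [mul_pow]; ring
  exact ⟨by positivity, fun q => (hmom q).1, fun q => (hmom q).2⟩

theorem factorial_two_mul_le (q : ℕ) : (2 * q).factorial ≤ q.factorial * (2 * q) ^ q := by
  have h := Nat.ascFactorial_le_pow_add q q
  rw [two_mul, ← Nat.factorial_mul_ascFactorial]
  gcongr

theorem factorialMoments_sq_of_hasSubgaussianMGF [IsProbabilityMeasure P] {X : Ω → ℝ} {c : ℝ≥0}
    (h : HasSubgaussianMGF X c P) :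
    FactorialMoments P (fun ω => X ω ^ 2) (2 * exp 1 * c) := by
  have hmom : ∀ q : ℕ, Integrable (fun ω => |X ω ^ 2| ^ q) P ∧
      ∫ ω, |X ω ^ 2| ^ q ∂P ≤ q.factorial * (2 * exp 1 * c) ^ q := by
    intro q
    rcases Nat.eq_zero_or_pos q with rfl | hq
    · simp
    have hX : MemLp X ((2 * q : ℕ) : ℝ≥0∞) P := by exact_mod_cast h.memLp (2 * q : ℕ)
    have hne : (2 * q : ℕ) ≠ 0 := by omega
    have hi := hX.integrable_norm_pow hne
    have heq : ∀ ω, |X ω ^ 2| ^ q = ‖X ω‖ ^ (2 * q) := fun ω => by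
      rw [abs_pow, ← pow_mul, Real.norm_eq_abs]
    simp_rw [heq]
    refine ⟨hi, ?_⟩
    rcases eq_or_ne c 0 with rfl | hc
    · have hz := h.ae_eq_zero_of_hasSubgaussianMGF_zero
      have : ∫ ω, ‖X ω‖ ^ (2 * q) ∂P = 0 := by
        rw [integral_eq_zero_of_ae]
        filter_upwards [hz] with ω hω
        simp [hω, hq.ne']
      rw [this]; positivity
    have hc0 : (0 : ℝ) < c := by positivity
    have hq0 : (0 : ℝ) < q := by exact_mod_cast hq
    -- This choice balances `l ^ (-2q)` against `exp (c l² / 2)`: the latter becomes `exp q`.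
    set l : ℝ := √(2 * q / c) with hl
    have hl0 : 0 < l := by positivity
    have hl2 : l ^ 2 = 2 * q / c := Real.sq_sqrt (by positivity)
    have hpt : ∀ ω, ‖X ω‖ ^ (2 * q) ≤
        (2 * q).factorial / l ^ (2 * q) * (exp (l * X ω) + exp (-l * X ω)) := fun ω => by
      have h1 := Real.pow_div_factorial_le_exp (x := l * |X ω|) (by positivity) (2 * q)
      have h2 : exp (l * |X ω|) ≤ exp (l * X ω) + exp (-l * X ω) := by
        rcases abs_cases (X ω) with ⟨h', -⟩ | ⟨h', -⟩ <;> rw [h']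
        · linarith [exp_pos (-l * X ω)]
        · have : l * -X ω = -l * X ω := by ring
          rw [this]; linarith [exp_pos (l * X ω)]
      rw [Real.norm_eq_abs, div_mul_eq_mul_div, le_div_iff₀ (by positivity)]
      rw [div_le_iff₀ (by positivity), mul_pow] at h1
      have hf : (0 : ℝ) < (2 * q).factorial := by positivity
      nlinarith
    have hle := integral_mono hi (((h.integrable_exp_mul l).add
      (h.integrable_exp_mul (-l))).const_mul ((2 * q).factorial / l ^ (2 * q))) hpt
    rw [integral_const_mul] at hle
    simp only [Pi.add_apply] at hle
    rw [integral_add (h.integrable_exp_mul l) (h.integrable_exp_mul (-l))] at hle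
    have m1 := h.mgf_le l
    have m2 := h.mgf_le (-l)
    have hexp : (c : ℝ) * l ^ 2 / 2 = q := by rw [hl2]; field_simp
    rw [neg_sq, hexp] at m2
    rw [hexp] at m1
    have h5 : exp (q : ℝ) = exp 1 ^ q := by rw [← exp_nat_mul]; simp
    have hfac : ((2 * q).factorial : ℝ) ≤ q.factorial * (2 * q) ^ q := by
      exact_mod_cast factorial_two_mul_le q
    calc _ ≤ _ := hle
      _ ≤ (q.factorial * (2 * q) ^ q) / l ^ (2 * q) * (exp q + exp q) := by
          exact mul_le_mul (by gcongr) (add_le_add m1 m2)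
            (add_nonneg (integral_nonneg fun ω => (exp_pos _).le)
              (integral_nonneg fun ω => (exp_pos _).le)) (by positivity)
      _ = 2 * (q.factorial * (exp 1 * c) ^ q) := by
          rw [pow_mul, hl2, h5, div_pow, mul_pow, mul_pow]; field_simp; ring
      _ ≤ 2 ^ q * (q.factorial * (exp 1 * c) ^ q) := by
          gcongr
          exact le_self_pow₀ (by norm_num) (by omega)
      _ = _ := by simp only [mul_pow]; ring
  exact ⟨by positivity, fun q => (hmom q).1, fun q => (hmom q).2⟩

end UserPCA
end Scalar

/-! ### Independence of blocks, U-statistics and the Chernoff bound -/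

section Blocks

open Real
open scoped Nat NNReal ENNReal

namespace UserPCA

variable {Ω : Type*} [MeasurableSpace Ω] {P : Measure Ω}

/-- Blocks of jointly independent random variables are independent. -/
theorem iIndepFun_curry {ι : Type*} {κ : ι → Type*} {𝓧 : (i : ι) → κ i → Type*}
    [∀ i j, MeasurableSpace (𝓧 i j)] {X : (i : ι) → (j : κ i) → Ω → 𝓧 i j}
    (mX : ∀ i j, Measurable (X i j))
    (h : iIndepFun (fun (p : (i : ι) × κ i) ω => X p.1 p.2 ω) P) :
    iIndepFun (fun i ω => (X i · ω)) P := by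
  have := h.isProbabilityMeasure
  have : ∀ i j, IsProbabilityMeasure (P.map (X i j)) :=
    fun i j => Measure.isProbabilityMeasure_map (mX i j).aemeasurable
  have h2 : ∀ i, iIndepFun (X i) P := fun i =>
    h.precomp (g := fun j : κ i => (⟨i, j⟩ : (i : ι) × κ i)) sigma_mk_injective
  have hc : (MeasurableEquiv.piCurry 𝓧) ∘ (fun ω p => X p.1 p.2 ω) = fun ω i j => X i j ω := by
    ext; simp [Sigma.curry]
  rw [iIndepFun_iff_map_fun_eq_infinitePi_map (by fun_prop)] at h ⊢
  have h3 := congrArg (Measure.map (MeasurableEquiv.piCurry 𝓧)) h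
  rw [Measure.map_map (by fun_prop) (by fun_prop), hc,
    Measure.infinitePi_map_piCurry (fun i j => P.map (X i j))] at h3
  rw [h3]
  congr 1 with i : 1
  rw [(iIndepFun_iff_map_fun_eq_infinitePi_map (by fun_prop)).1 (h2 i)]

theorem HasSubGaussianConst.hasSubgaussianMGF [IsProbabilityMeasure P] {X : Ω → ℝ} {b : ℝ}
    (hb : 0 ≤ b) (h : HasSubGaussianConst P X b) (h0 : ∫ ω, X ω ∂P = 0) :
    HasSubgaussianMGF X (10 * exp 1 * b ^ 2).toNNReal P := by
  have h1 := h.factorialMoments_sq hb h0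
  have h2 : FactorialMoments P (fun ω => X ω ^ 2) ((2 * exp 1 * b ^ 2).toNNReal : ℝ≥0) := by
    rwa [Real.coe_toNNReal _ (by positivity)]
  convert! h2.hasSubgaussianMGF h.1 h0 using 1
  have : (5 : ℝ≥0) = (5 : ℝ).toNNReal := by simp
  rw [this, ← Real.toNNReal_mul (by norm_num)]
  congr 1; ring

theorem HasSubGaussianConst.ae_eq_zero [IsProbabilityMeasure P] {X : Ω → ℝ}
    (h : HasSubGaussianConst P X 0) (h0 : ∫ ω, X ω ∂P = 0) : X =ᵐ[P] 0 := by
  have h1 := h.hasSubgaussianMGF le_rfl h0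
  simp only [ne_eq, OfNat.ofNat_ne_zero, not_false_eq_true, zero_pow, mul_zero,
    Real.toNNReal_zero] at h1
  exact h1.ae_eq_zero_of_hasSubgaussianMGF_zero

/-- The degree two U-statistic `1 / (m (m - 1)) ∑_{j₁ ≠ j₂} a_{j₁} a_{j₂}`. -/
noncomputable def uStat {m : ℕ} (a : Fin m → ℝ) : ℝ :=
  ((m : ℝ) * ((m : ℝ) - 1))⁻¹ * ((∑ j, a j) ^ 2 - ∑ j, a j ^ 2)

theorem sum_offDiag_mul {m : ℕ} (a : Fin m → ℝ) :
    (∑ j₁, ∑ j₂, if j₁ ≠ j₂ then a j₁ * a j₂ else 0) = (∑ j, a j) ^ 2 - ∑ j, a j ^ 2 := by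
  rw [eq_sub_iff_add_eq, sq, Finset.sum_mul_sum, ← Finset.sum_add_distrib]
  refine Finset.sum_congr rfl fun j _ => ?_
  have : a j ^ 2 = ∑ j₂, if j = j₂ then a j * a j₂ else 0 := by simp [sq]
  rw [this, ← Finset.sum_add_distrib]
  refine Finset.sum_congr rfl fun j₂ _ => ?_
  by_cases h : j = j₂ <;> simp [h]

/-- Expanding the squares, the constant appears `m (m - 1)` times and each `a j` has coefficient `2
c (m - 1)`. The signal thus separates from a linear and a purely quadratic noise term. -/
theorem uStat_const_add {m : ℕ} (hm : 2 ≤ m) (c : ℝ) (a : Fin m → ℝ) :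
    uStat (fun j => c + a j) = c ^ 2 + ∑ j, 2 * c / m * a j + uStat a := by
  have h1 : (0 : ℝ) < m := by exact_mod_cast (by omega : 0 < m)
  have h2 : (0 : ℝ) < (m : ℝ) - 1 := by
    have : (2 : ℝ) ≤ m := by exact_mod_cast hm
    linarith
  simp only [uStat, add_sq, Finset.sum_add_distrib, ← Finset.mul_sum, Finset.sum_const,
    Finset.card_univ, Fintype.card_fin, nsmul_eq_mul]
  field_simp
  ring

theorem abs_sub_pow_le_add_pow {x y : ℝ} (hx : 0 ≤ x) (hy : 0 ≤ y) (q : ℕ) :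
    |x - y| ^ q ≤ x ^ q + y ^ q := by
  rcases le_total x y with h | h
  · rw [abs_of_nonpos (by linarith)]
    have : (-(x - y)) ^ q ≤ y ^ q := by gcongr <;> linarith
    have := pow_nonneg hx q
    linarith
  · rw [abs_of_nonneg (by linarith)]
    have : (x - y) ^ q ≤ x ^ q := by gcongr; linarith
    have := pow_nonneg hy q
    linarith

/-- By the power mean inequality; no independence is involved. -/
theorem FactorialMoments.sum {m : ℕ} {X : Fin m → Ω → ℝ} {K : ℝ} (hK : 0 ≤ K)
    (h : ∀ j, FactorialMoments P (X j) K) (hX0 : ∀ j ω, 0 ≤ X j ω)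
    (hX : ∀ j, AEStronglyMeasurable (X j) P) [IsProbabilityMeasure P] :
    FactorialMoments P (fun ω => ∑ j, X j ω) (m * K) := by
  have hmom : ∀ q : ℕ, Integrable (fun ω => |∑ j, X j ω| ^ q) P ∧
      ∫ ω, |∑ j, X j ω| ^ q ∂P ≤ q.factorial * (m * K) ^ q := by
    intro q
    rcases q with _ | q
    · simp
    have hle : ∀ ω, |∑ j, X j ω| ^ (q + 1) ≤ m ^ q * ∑ j, |X j ω| ^ (q + 1) := fun ω => by
      rw [abs_of_nonneg (Finset.sum_nonneg fun j _ => hX0 j ω)]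
      simp_rw [fun j => abs_of_nonneg (hX0 j ω)]
      simpa using pow_sum_le_card_mul_sum_pow (s := Finset.univ) (f := fun j => X j ω)
        (fun j _ => hX0 j ω) q
    have hi : Integrable (fun ω => (m : ℝ) ^ q * ∑ j, |X j ω| ^ (q + 1)) P :=
      (integrable_finsetSum _ fun j _ => (h j).integrable (q + 1)).const_mul _
    have hi1 : Integrable (fun ω => |∑ j, X j ω| ^ (q + 1)) P := by
      refine hi.mono' ?_ (.of_forall fun ω => ?_)
      · exact ((Finset.aestronglyMeasurable_fun_sum _ fun j _ => hX j).norm).pow _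
      · rw [Real.norm_eq_abs, abs_of_nonneg (by positivity)]; exact hle ω
    refine ⟨hi1, (integral_mono hi1 hi hle).trans ?_⟩
    rw [integral_const_mul, integral_finsetSum _ fun j _ => (h j).integrable (q + 1)]
    calc (m : ℝ) ^ q * ∑ j, ∫ ω, |X j ω| ^ (q + 1) ∂P
        ≤ (m : ℝ) ^ q * ∑ _j : Fin m, ((q + 1).factorial * K ^ (q + 1)) := by
          gcongr with j
          exact (h j).le _
      _ = _ := by simp [mul_pow]; ring
  exact ⟨by positivity, fun q => (hmom q).1, fun q => (hmom q).2⟩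

/-- No decoupling is needed. By independence `∑ a j` has variance proxy of order `m b²`, so its
square is sub-exponential at scale `m b²`; `∑ a j ²` has that scale by mere summation. Dividing the
difference by `m (m - 1) ≥ m² / 2` gives `b² / m`. The mean vanishes because the variance of the sum
is the sum of the variances. -/
theorem uStat_factorialMoments [IsProbabilityMeasure P] {m : ℕ} (hm : 2 ≤ m)
    {a : Fin m → Ω → ℝ} {b : ℝ} (hb : 0 ≤ b) (ha : ∀ j, Measurable (a j))
    (hind : iIndepFun a P) (hsub : ∀ j, HasSubGaussianConst P (a j) b)
    (h0 : ∀ j, ∫ ω, a j ω ∂P = 0) :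
    FactorialMoments P (fun ω => uStat fun j => a j ω) (80 * exp 1 ^ 2 * (b ^ 2 / m)) ∧
      ∫ ω, uStat (fun j => a j ω) ∂P = 0 := by
  have hm0 : (0 : ℝ) < m := by exact_mod_cast (by omega : 0 < m)
  have hm1 : (0 : ℝ) < (m : ℝ) - 1 := by
    have : (2 : ℝ) ≤ m := by exact_mod_cast hm
    linarith
  have hS := HasSubgaussianMGF.sum_of_iIndepFun hind (s := Finset.univ)
    fun j _ => (hsub j).hasSubgaussianMGF hb (h0 j)
  have hS2 := factorialMoments_sq_of_hasSubgaussianMGF hS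
  have hsq : FactorialMoments P (fun ω => ∑ j, a j ω ^ 2) (m * (2 * exp 1 * b ^ 2)) :=
    FactorialMoments.sum (X := fun j ω => a j ω ^ 2) (by positivity)
      (fun j => (hsub j).factorialMoments_sq hb (h0 j))
      (fun j ω => sq_nonneg _) fun j => ((ha j).pow_const 2).aestronglyMeasurable
  have hconst : 2 * exp 1 * ((∑ j : Fin m, (10 * exp 1 * b ^ 2).toNNReal : ℝ≥0) : ℝ)
      = m * (20 * exp 1 ^ 2 * b ^ 2) := by
    simp only [Finset.sum_const, Finset.card_univ, Fintype.card_fin, nsmul_eq_mul, NNReal.coe_mul,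
      NNReal.coe_natCast]
    rw [Real.coe_toNNReal _ (by positivity)]; ring
  rw [hconst] at hS2
  have he : (1 : ℝ) ≤ exp 1 := Real.one_le_exp (by norm_num)
  have hsq' : FactorialMoments P (fun ω => ∑ j, a j ω ^ 2) (m * (20 * exp 1 ^ 2 * b ^ 2)) :=
    hsq.mono (by gcongr <;> nlinarith)
  constructor
  · have hmeas : Measurable fun ω => uStat fun j => a j ω := by unfold uStat; fun_prop
    set B : ℝ := m * (20 * exp 1 ^ 2 * b ^ 2) with hB
    have hB0 : 0 ≤ B := by positivity
    have hmom : ∀ q : ℕ, Integrable (fun ω => |uStat fun j => a j ω| ^ q) P ∧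
        ∫ ω, |uStat fun j => a j ω| ^ q ∂P ≤
          q.factorial * (80 * exp 1 ^ 2 * (b ^ 2 / m)) ^ q := by
      intro q
      rcases Nat.eq_zero_or_pos q with rfl | hq
      · simp
      have hle : ∀ ω, |uStat fun j => a j ω| ^ q ≤ (((m : ℝ) * ((m : ℝ) - 1))⁻¹) ^ q *
          (|(∑ j, a j ω) ^ 2| ^ q + |∑ j, a j ω ^ 2| ^ q) := fun ω => by
        have h1 : 0 ≤ ∑ j, a j ω ^ 2 := Finset.sum_nonneg fun j _ => sq_nonneg _
        rw [uStat, abs_mul, mul_pow, abs_of_pos (by positivity : 0 < ((m : ℝ) * ((m : ℝ) - 1))⁻¹),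
          abs_of_nonneg (sq_nonneg (∑ j, a j ω)), abs_of_nonneg h1]
        gcongr
        exact abs_sub_pow_le_add_pow (sq_nonneg _) h1 q
      have hi := ((hS2.integrable q).add (hsq'.integrable q)).const_mul
        ((((m : ℝ) * ((m : ℝ) - 1))⁻¹) ^ q)
      have hi1 : Integrable (fun ω => |uStat fun j => a j ω| ^ q) P := by
        refine hi.mono' (hmeas.norm.pow_const q).aestronglyMeasurable (.of_forall fun ω => ?_)
        rw [Real.norm_eq_abs, abs_of_nonneg (by positivity)]; exact hle ω
      refine ⟨hi1, (integral_mono hi1 hi hle).trans ?_⟩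
      rw [integral_const_mul]
      simp only [Pi.add_apply]
      rw [integral_add (hS2.integrable q) (hsq'.integrable q)]
      have hm2 : (m : ℝ) ≤ 2 * (m - 1) := by
        have : (2 : ℝ) ≤ m := by exact_mod_cast hm
        linarith
      calc (((m : ℝ) * ((m : ℝ) - 1))⁻¹) ^ q * (_ + _)
          ≤ (((m : ℝ) * ((m : ℝ) - 1))⁻¹) ^ q * (q.factorial * B ^ q + q.factorial * B ^ q) := by
            gcongr
            exacts [hS2.le q, hsq'.le q]
        _ = q.factorial * (2 * (((m : ℝ) * ((m : ℝ) - 1))⁻¹ * B) ^ q) := by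
            rw [mul_pow]; ring
        _ ≤ q.factorial * (2 ^ q * (((m : ℝ) * ((m : ℝ) - 1))⁻¹ * B) ^ q) := by
            gcongr
            exact le_self_pow₀ (by norm_num) (by omega)
        _ = q.factorial * (2 * (((m : ℝ) * ((m : ℝ) - 1))⁻¹ * B)) ^ q := by rw [← mul_pow]
        _ ≤ _ := by
            refine mul_le_mul_of_nonneg_left (pow_le_pow_left₀ (by positivity) ?_ q) (by positivity)
            have : 2 * (((m : ℝ) * ((m : ℝ) - 1))⁻¹ * B) = 40 * exp 1 ^ 2 * b ^ 2 / (m - 1) := by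
              rw [hB]; field_simp; ring
            rw [this, div_le_iff₀ hm1]
            have : 80 * exp 1 ^ 2 * (b ^ 2 / m) * (m - 1)
              = 40 * exp 1 ^ 2 * b ^ 2 * (2 * (m - 1) / m) := by field_simp; ring
            rw [this]
            apply le_mul_of_one_le_right (by positivity)
            rwa [one_le_div hm0]
    exact ⟨by positivity, fun q => (hmom q).1, fun q => (hmom q).2⟩
  · have hL2 : ∀ j, MemLp (a j) 2 P := fun j => by
      exact_mod_cast ((hsub j).hasSubgaussianMGF hb (h0 j)).memLp 2
    have hv := IndepFun.variance_sum (μ := P) (X := a) (s := Finset.univ) (fun j _ => hL2 j)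
      fun i _ j _ hij => hind.indepFun hij
    have hSm : ∫ ω, (∑ j, a j) ω ∂P = 0 := by
      simp only [Finset.sum_apply]
      rw [integral_finsetSum _ fun j _ => (hsub j).1]
      simp [h0]
    rw [variance_of_integral_eq_zero (Finset.aemeasurable_sum _ fun j _ => (ha j).aemeasurable) hSm,
      Finset.sum_congr rfl fun j _ => variance_of_integral_eq_zero (ha j).aemeasurable (h0 j)] at hv
    have hi1 : Integrable (fun ω => (∑ j, a j ω) ^ 2) P := by
      simpa using hS2.integrable 1
    have hi2 : ∀ j, Integrable (fun ω => a j ω ^ 2) P := fun j => (hL2 j).integrable_sq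
    unfold uStat
    rw [integral_const_mul, integral_sub hi1 (integrable_finsetSum _ fun j _ => hi2 j),
      integral_finsetSum _ fun j _ => hi2 j]
    simp only [Finset.sum_apply] at hv
    rw [hv, sub_self, mul_zero]

/-- Chernoff bound for sums of independent centred sub-exponential variables. -/
theorem measure_sum_ge_le_of_factorialMoments [IsProbabilityMeasure P] {n : ℕ}
    {X : Fin n → Ω → ℝ} {K : ℝ} (hX : ∀ i, Measurable (X i)) (hind : iIndepFun X P)
    (h : ∀ i, FactorialMoments P (X i) K) (h0 : ∀ i, ∫ ω, X i ω ∂P = 0) {l r : ℝ} (hl0 : 0 ≤ l)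
    (hl : l * K ≤ 1 / 2) :
    P.real {ω | r ≤ ∑ i, X i ω} ≤ exp (-l * r + n * (2 * (l * K) ^ 2)) := by
  have hl' : |l| * K ≤ 1 / 2 := by rwa [abs_of_nonneg hl0]
  have hi : ∀ i ∈ Finset.univ, Integrable (fun ω => exp (l * X i ω)) P := fun i _ =>
    ((h i).hasSum_integral_exp (hX i).aestronglyMeasurable
      (lt_of_le_of_lt hl' (by norm_num))).1
  have h1 := measure_ge_le_exp_mul_mgf (X := ∑ i, X i) (μ := P) r hl0
    (hind.integrable_exp_mul_sum hX hi)
  rw [hind.mgf_sum hX] at h1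
  simp only [Finset.sum_apply] at h1
  refine h1.trans ?_
  rw [exp_add]
  gcongr
  calc ∏ i, mgf (X i) P l ≤ ∏ _i : Fin n, exp (2 * (|l| * K) ^ 2) := by
        gcongr with i
        · exact fun i _ => mgf_nonneg
        · exact (h i).mgf_le (hX i).aestronglyMeasurable (h0 i) hl'
    _ = _ := by
        rw [abs_of_nonneg hl0]
        simp only [Finset.prod_const, Finset.card_univ, Fintype.card_fin, ← exp_nat_mul]

end UserPCA
end Blocks

/-! ### Bernstein-type tails in a fixed direction -/

section Tail

open Real
open scoped Nat NNReal ENNReal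

namespace UserPCA

variable {Ω : Type*} [MeasurableSpace Ω] {P : Measure Ω}

theorem FactorialMoments.neg {X : Ω → ℝ} {K : ℝ} (h : FactorialMoments P X K) :
    FactorialMoments P (fun ω => -X ω) K :=
  ⟨h.nonneg, by simpa using h.integrable, by simpa using h.le⟩

theorem HasSubgaussianMGF_mono {X : Ω → ℝ} {c c' : ℝ≥0} (h : HasSubgaussianMGF X c P)
    (hc : c ≤ c') : HasSubgaussianMGF X c' P :=
  ⟨h.integrable_exp_mul, fun l => (h.mgf_le l).trans (by gcongr)⟩

theorem HasSubgaussianMGF_const_mul {X : Ω → ℝ} {v : ℝ} (h : HasSubgaussianMGF X v.toNNReal P)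
    (r : ℝ) : HasSubgaussianMGF (fun ω => r * X ω) (r ^ 2 * v).toNNReal P := by
  refine HasSubgaussianMGF_mono (h.const_mul r) ?_
  rw [Real.toNNReal_mul (sq_nonneg r)]
  have hle : ∀ x : ℝ≥0, (x : ℝ) = r ^ 2 → x ≤ (r ^ 2).toNNReal := fun x hx => by
    rw [← hx, Real.toNNReal_coe]
  exact mul_le_mul_left (hle _ rfl) _

theorem measure_lt_abs_le [IsFiniteMeasure P] {X : Ω → ℝ} {α β : ℝ}
    (h1 : P.real {ω | α ≤ X ω} ≤ β) (h2 : P.real {ω | α ≤ -X ω} ≤ β) :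
    P.real {ω | α < |X ω|} ≤ 2 * β := by
  calc P.real {ω | α < |X ω|} ≤ P.real ({ω | α ≤ X ω} ∪ {ω | α ≤ -X ω}) := by
        refine measureReal_mono (fun ω hω => ?_) (by finiteness)
        rcases lt_abs.1 (show α < |X ω| from hω) with h | h
        · exact Or.inl h.le
        · exact Or.inr h.le
    _ ≤ _ := measureReal_union_le _ _
    _ ≤ 2 * β := by linarith

/-- Two-sided form of the Chernoff bound, in the two regimes of Bernstein's inequality. -/
theorem measure_lt_abs_sum_le_of_factorialMoments [IsProbabilityMeasure P] {n : ℕ}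
    {X : Fin n → Ω → ℝ} {K s : ℝ} (hX : ∀ i, Measurable (X i)) (hind : iIndepFun X P)
    (h : ∀ i, FactorialMoments P (X i) K) (h0 : ∀ i, ∫ ω, X i ω ∂P = 0) (hK : 0 < K)
    (hs : 0 < s) :
    P.real {ω | n * (7 * K * (s + s ^ 2)) < |∑ i, X i ω|} ≤ 2 * exp (-(3 * (n * s ^ 2))) := by
  have key : ∀ Y : Fin n → Ω → ℝ, (∀ i, Measurable (Y i)) → iIndepFun Y P →
      (∀ i, FactorialMoments P (Y i) K) → (∀ i, ∫ ω, Y i ω ∂P = 0) →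
      P.real {ω | n * (7 * K * (s + s ^ 2)) ≤ ∑ i, Y i ω} ≤ exp (-(3 * (n * s ^ 2))) := by
    intro Y hY hYi hYm hY0
    have hn : (0 : ℝ) ≤ n := Nat.cast_nonneg n
    -- Take `l = s / (2K)` for `s ≤ 1` and the largest admissible `l = 1 / (2K)` otherwise. The
    -- factor 7 gives `-7/2` in the exponent; the generating function costs at most `1/2`, leaving
    -- `-3`.
    rcases le_total s 1 with hs1 | hs1
    · have hlK : s / (2 * K) * K = s / 2 := by field_simp
      refine (measure_sum_ge_le_of_factorialMoments hY hYi hYm hY0 (l := s / (2 * K))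
        (by positivity) (by rw [hlK]; linarith)).trans ?_
      gcongr
      have : -(s / (2 * K)) * (n * (7 * K * (s + s ^ 2))) = -(n * (7 / 2 * (s ^ 2 + s ^ 3))) := by
        field_simp
      rw [hlK, this]
      have := mul_nonneg hn (pow_pos hs 3).le
      nlinarith
    · have hlK : 1 / (2 * K) * K = 1 / 2 := by field_simp
      refine (measure_sum_ge_le_of_factorialMoments hY hYi hYm hY0 (l := 1 / (2 * K))
        (by positivity) hlK.le).trans ?_
      gcongr
      have : -(1 / (2 * K)) * (n * (7 * K * (s + s ^ 2))) = -(n * (7 / 2 * (s + s ^ 2))) := by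
        field_simp
      rw [hlK, this]
      have h1 := mul_le_mul_of_nonneg_left hs1 hn
      have h2 := mul_nonneg hn (sq_nonneg s)
      nlinarith
  refine measure_lt_abs_le (key X hX hind h h0) ?_
  have := key (fun i ω => -X i ω) (fun i => (hX i).neg)
    (hind.comp (fun _ x => -x) fun _ => measurable_neg) (fun i => (h i).neg)
    fun i => by rw [integral_neg, h0, neg_zero]
  simpa only [Finset.sum_neg_distrib] using this

variable {n : ℕ} {m : Fin n → ℕ} {η : Fin n → ℝ} {t σ s : ℝ} {c : Fin n → ℝ}
  {a : (i : Fin n) → Fin (m i) → Ω → ℝ}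

/-- The variance proxies add up to `∑ m i (2 c i / m i)² · 10 e η i ²`, which is at most `40 e t² n
σ²`. -/
theorem linear_tail [IsProbabilityMeasure P] (hn : 0 < n) (hm : ∀ i, 2 ≤ m i) (hη : ∀ i, 0 ≤ η i)
    (ht0 : 0 < t) (ht : ∀ i, η i ^ 2 / m i ≤ t ^ 2) (hσ : 0 < σ) (hs : 0 < s)
    (hc : ∑ i, c i ^ 2 ≤ n * σ ^ 2)
    (hind : iIndepFun (fun p : (i : Fin n) × Fin (m i) => a p.1 p.2) P)
    (hsub : ∀ i j, HasSubGaussianConst P (a i j) (η i)) (h0 : ∀ i j, ∫ ω, a i j ω ∂P = 0) :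
    P.real {ω | n * (27 * (t * σ * s)) < |∑ i, ∑ j, 2 * c i / m i * a i j ω|} ≤
      2 * exp (-(3 * (n * s ^ 2))) := by
  have hn0 : (0 : ℝ) < n := by exact_mod_cast hn
  have hS := HasSubgaussianMGF.sum_of_iIndepFun (s := Finset.univ)
    (hind.comp (fun p x => 2 * c p.1 / m p.1 * x) fun p => measurable_const_mul _)
    fun p _ => HasSubgaussianMGF_const_mul
      ((hsub p.1 p.2).hasSubgaussianMGF (hη p.1) (h0 p.1 p.2)) (2 * c p.1 / m p.1)
  have hle : (∑ p : (i : Fin n) × Fin (m i), ((2 * c p.1 / m p.1) ^ 2 *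
      (10 * exp 1 * η p.1 ^ 2)).toNNReal) ≤ (40 * exp 1 * t ^ 2 * (n * σ ^ 2)).toNNReal := by
    rw [← NNReal.coe_le_coe, Real.coe_toNNReal _ (by positivity)]
    push_cast
    rw [Fintype.sum_sigma]
    calc _ = ∑ i, 40 * exp 1 * (η i ^ 2 / m i) * c i ^ 2 := by
          refine Finset.sum_congr rfl fun i _ => ?_
          have : (0 : ℝ) < m i := by exact_mod_cast (by have := hm i; omega : 0 < m i)
          rw [Finset.sum_congr rfl fun j _ => Real.coe_toNNReal _ (by positivity)]
          simp only [Finset.sum_const, Finset.card_univ, Fintype.card_fin, nsmul_eq_mul]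
          field_simp
          ring
      _ ≤ ∑ i, 40 * exp 1 * t ^ 2 * c i ^ 2 := by
          gcongr with i
          exact ht i
      _ ≤ _ := by
          rw [← Finset.mul_sum]
          gcongr
  have hS' := HasSubgaussianMGF_mono hS hle
  have hsum : ∀ ω, ∑ p : (i : Fin n) × Fin (m i),
      (((fun x => 2 * c p.1 / m p.1 * x) ∘ a p.1 p.2) ω) =
        ∑ i, ∑ j, 2 * c i / m i * a i j ω := fun ω => by
    rw [Fintype.sum_sigma]; rfl
  simp_rw [hsum] at hS'
  -- The constant 27 is large enough: `27² / (80 e) ≥ 729 / 240 > 3`.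
  have hexp : -(n * (27 * (t * σ * s))) ^ 2 /
      (2 * ((40 * exp 1 * t ^ 2 * (n * σ ^ 2)).toNNReal : ℝ≥0)) ≤ -(3 * (n * s ^ 2)) := by
    rw [Real.coe_toNNReal _ (by positivity), neg_div, neg_le_neg_iff, le_div_iff₀ (by positivity)]
    have he : exp 1 < 3 := by have := Real.exp_one_lt_d9; linarith
    have hp : 0 ≤ (n * (t * σ * s)) ^ 2 := sq_nonneg _
    nlinarith
  have hα : 0 ≤ n * (27 * (t * σ * s)) := by positivity
  exact measure_lt_abs_le ((hS'.measure_ge_le hα).trans (exp_le_exp.2 hexp))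
    ((hS'.neg.measure_ge_le hα).trans (exp_le_exp.2 hexp))

theorem quadratic_tail [IsProbabilityMeasure P] (hm : ∀ i, 2 ≤ m i) (hη : ∀ i, 0 ≤ η i)
    (ht0 : 0 < t) (ht : ∀ i, η i ^ 2 / m i ≤ t ^ 2) (hs : 0 < s)
    (ha : ∀ i j, Measurable (a i j))
    (hind : iIndepFun (fun p : (i : Fin n) × Fin (m i) => a p.1 p.2) P)
    (hsub : ∀ i j, HasSubGaussianConst P (a i j) (η i)) (h0 : ∀ i j, ∫ ω, a i j ω ∂P = 0) :
    P.real {ω | n * (7 * (80 * exp 1 ^ 2 * t ^ 2) * (s + s ^ 2)) <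
      |∑ i, uStat fun j => a i j ω|} ≤ 2 * exp (-(3 * (n * s ^ 2))) := by
  have hu := fun i => uStat_factorialMoments (hm i) (hη i) (ha i)
    (hind.precomp (g := fun j : Fin (m i) => (⟨i, j⟩ : (i : Fin n) × Fin (m i)))
      (fun _ _ h => by simpa using h)) (hsub i) (h0 i)
  have hmeas : ∀ i, Measurable (fun x : Fin (m i) → ℝ => uStat x) := fun i => by
    unfold uStat; fun_prop
  refine measure_lt_abs_sum_le_of_factorialMoments
    (X := fun i ω => uStat fun j => a i j ω)
    (fun i => (hmeas i).comp (measurable_pi_lambda _ (ha i)))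
    ((iIndepFun_curry ha hind).comp (fun i x => uStat x) hmeas)
    (fun i => (hu i).1.mono ?_) (fun i => (hu i).2) (by positivity) hs
  gcongr
  exact ht i

/-- Deviation of the quadratic form of the estimator in one direction. -/
theorem direction_tail [IsProbabilityMeasure P] (hn : 0 < n) (hm : ∀ i, 2 ≤ m i)
    (hη : ∀ i, 0 ≤ η i) (ht0 : 0 ≤ t) (ht : ∀ i, η i ^ 2 / m i ≤ t ^ 2) (hσ : 0 < σ) (hs : 0 < s)
    (hc : ∑ i, c i ^ 2 ≤ n * σ ^ 2) (ha : ∀ i j, Measurable (a i j))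
    (hind : iIndepFun (fun p : (i : Fin n) × Fin (m i) => a p.1 p.2) P)
    (hsub : ∀ i j, HasSubGaussianConst P (a i j) (η i)) (h0 : ∀ i j, ∫ ω, a i j ω ∂P = 0) :
    P.real {ω | 27 * (t * σ * s) + 5040 * t ^ 2 * (s + s ^ 2) <
      |∑ i, 1 / (n : ℝ) * (uStat (fun j => c i + a i j ω) - c i ^ 2)|} ≤
        4 * exp (-(3 * (n * s ^ 2))) := by
  have hn0 : (0 : ℝ) < n := by exact_mod_cast hn
  have heq : ∀ ω, ∑ i, 1 / (n : ℝ) * (uStat (fun j => c i + a i j ω) - c i ^ 2) =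
      1 / n * (∑ i, ∑ j, 2 * c i / m i * a i j ω + ∑ i, uStat fun j => a i j ω) := fun ω => by
    rw [← Finset.mul_sum, ← Finset.sum_add_distrib]
    congr 1
    refine Finset.sum_congr rfl fun i _ => ?_
    rw [uStat_const_add (hm i)]; ring
  simp_rw [heq]
  -- The tail bounds need a positive scale. If `t = 0`, every `η i` is zero and the noise vanishes
  -- almost surely.
  rcases ht0.eq_or_lt with rfl | ht0
  · have hη0 : ∀ i, η i = 0 := fun i => by
      have h1 := ht i
      have : (0 : ℝ) < m i := by exact_mod_cast (by have := hm i; omega : 0 < m i)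
      rw [div_le_iff₀ this] at h1
      have : η i ^ 2 = 0 := le_antisymm (by linarith) (sq_nonneg _)
      exact pow_eq_zero_iff (two_ne_zero) |>.1 this
    have hz : ∀ᵐ ω ∂P, ∀ i j, a i j ω = 0 := by
      rw [ae_all_iff]; intro i
      rw [ae_all_iff]; intro j
      have h1 := hsub i j
      rw [hη0 i] at h1
      exact h1.ae_eq_zero (h0 i j)
    rw [(measureReal_eq_zero_iff (by finiteness)).2]
    · positivity
    · rw [measure_eq_zero_iff_ae_notMem]
      filter_upwards [hz] with ω hω
      simp [hω, uStat]
  · have h1 := linear_tail hn hm hη ht0 ht hσ hs hc hind hsub h0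
    have h2 := quadratic_tail hm hη ht0 ht hs ha hind hsub h0
    calc _ ≤ P.real ({ω | n * (27 * (t * σ * s)) < |∑ i, ∑ j, 2 * c i / m i * a i j ω|} ∪
          {ω | n * (7 * (80 * exp 1 ^ 2 * t ^ 2) * (s + s ^ 2)) <
            |∑ i, uStat fun j => a i j ω|}) := by
          refine measureReal_mono (fun ω hω => ?_) (by finiteness)
          by_contra hcon
          simp only [Set.mem_union, Set.mem_ofPred_eq, not_or, not_lt] at hcon hω
          have he : exp 1 ^ 2 ≤ 9 := by
            have := Real.exp_one_lt_d9
            have := exp_pos 1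
            nlinarith
          have hab := abs_add_le (∑ i, ∑ j, 2 * c i / m i * a i j ω) (∑ i, uStat fun j => a i j ω)
          rw [abs_mul, abs_of_pos (by positivity : 0 < 1 / (n : ℝ)), one_div,
            lt_inv_mul_iff₀ hn0] at hω
          have h3 : n * (7 * (80 * exp 1 ^ 2 * t ^ 2) * (s + s ^ 2)) ≤
              n * (5040 * t ^ 2 * (s + s ^ 2)) := by
            have : 7 * (80 * exp 1 ^ 2 * t ^ 2) = exp 1 ^ 2 * (560 * t ^ 2) := by ring
            have h5 : 5040 * t ^ 2 = 9 * (560 * t ^ 2) := by ring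
            rw [this, h5]
            gcongr
          linarith [hcon.1, hcon.2]
      _ ≤ _ := measureReal_union_le _ _
      _ ≤ _ := by linarith

end UserPCA
end Tail

/-! ### Nets of the sphere and perturbation of eigenspaces -/

section LinearAlgebra

open Module
open scoped InnerProductSpace

namespace UserPCA

variable {E : Type*} [NormedAddCommGroup E] [InnerProductSpace ℝ E]
  {ι : Type*} [Fintype ι]

/-- The sphere of a `d`-dimensional space has a `1/2`-net with at most `5 ^ d` points. -/
theorem exists_half_net (E : Type*) [NormedAddCommGroup E] [InnerProductSpace ℝ E]
    [FiniteDimensional ℝ E] :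
    ∃ N : Finset E, N.card ≤ 5 ^ finrank ℝ E ∧ (∀ u ∈ N, ‖u‖ = 1) ∧
      ∀ x : E, ‖x‖ = 1 → ∃ u ∈ N, ‖u - x‖ ≤ 1 / 2 := by
  classical
  let S : Set ℕ := {q | ∃ N : Finset E, N.card = q ∧ (∀ u ∈ N, ‖u‖ = 1) ∧
    ∀ u ∈ N, ∀ v ∈ N, u ≠ v → 1 / 2 ≤ ‖u - v‖}
  have hbd : ∀ N : Finset E, (∀ u ∈ N, ‖u‖ = 1) →
      (∀ u ∈ N, ∀ v ∈ N, u ≠ v → 1 / 2 ≤ ‖u - v‖) → N.card ≤ 5 ^ finrank ℝ E := by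
    intro N h1 h2
    -- Doubling turns a `1/2`-separated set in the unit sphere into a `1`-separated set in the ball
    -- of radius 2, the setting of the `5 ^ d` packing bound.
    have hinj : Function.Injective fun u : E => (2 : ℝ) • u :=
      smul_right_injective E (two_ne_zero)
    rw [← Finset.card_image_of_injective N hinj]
    apply Besicovitch.card_le_of_separated
    · intro c hc
      obtain ⟨u, hu, rfl⟩ := Finset.mem_image.1 hc
      simp [norm_smul, h1 u hu]
    · intro c hc e he hce
      obtain ⟨u, hu, rfl⟩ := Finset.mem_image.1 hc
      obtain ⟨v, hv, rfl⟩ := Finset.mem_image.1 he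
      have := h2 u hu v hv (fun h => hce (by rw [h]))
      rw [← smul_sub, norm_smul]
      norm_num
      linarith
  have hS : BddAbove S := ⟨5 ^ finrank ℝ E, by
    rintro q ⟨N, rfl, h1, h2⟩
    exact hbd N h1 h2⟩
  have hne : S.Nonempty := ⟨0, ∅, by simp⟩
  -- A separated set of maximal cardinality is a net: an uncovered point could be added to it.
  obtain ⟨N, hN, h1, h2⟩ := Nat.sSup_mem hne hS
  refine ⟨N, hbd N h1 h2, h1, fun x hx => ?_⟩
  by_contra! hcon
  have hxN : x ∉ N := fun h => by
    have := hcon x h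
    simp at this
    linarith
  have hmem : (insert x N).card ∈ S := by
    refine ⟨insert x N, rfl, ?_, ?_⟩
    · intro u hu
      rcases Finset.mem_insert.1 hu with rfl | hu
      · exact hx
      · exact h1 u hu
    · intro u hu v hv huv
      rcases Finset.mem_insert.1 hu with rfl | hu' <;> rcases Finset.mem_insert.1 hv with rfl | hv'
      · exact absurd rfl huv
      · rw [norm_sub_rev]; exact (hcon v hv').le
      · exact (hcon u hu').le
      · exact h2 u hu' v hv' huv
  have := le_csSup hS hmem
  rw [Finset.card_insert_of_notMem hxN, hN] at this
  omega

/-- A symmetric operator is controlled by its quadratic form on a `1/2`-net of the sphere. -/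
theorem norm_apply_le_of_half_net [FiniteDimensional ℝ E] {T : E →ₗ[ℝ] E} (hT : T.IsSymmetric) {N : Finset E}
    (hN1 : ∀ u ∈ N, ‖u‖ = 1) (hN : ∀ x : E, ‖x‖ = 1 → ∃ u ∈ N, ‖u - x‖ ≤ 1 / 2) {r : ℝ}
    (hr : 0 ≤ r) (h : ∀ u ∈ N, |⟪u, T u⟫_ℝ| ≤ r) (x : E) : ‖T x‖ ≤ 2 * r * ‖x‖ := by
  set b := hT.eigenvectorBasis (n := finrank ℝ E) rfl
  set ev := hT.eigenvalues (n := finrank ℝ E) rfl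
  have hb : ∀ i, T (b i) = ev i • b i := fun i => by
    exact hT.apply_eigenvectorBasis (n := finrank ℝ E) rfl i
  have hTc : ∀ (i) (y : E), ⟪b i, T y⟫_ℝ = ev i * ⟪b i, y⟫_ℝ := fun i y => by
    rw [← hT, hb, real_inner_smul_left]
  have hsq : ∀ y : E, ‖y‖ ^ 2 = ∑ i, ⟪b i, y⟫_ℝ ^ 2 := fun y => by
    rw [← b.sum_sq_norm_inner_right y]; simp
  rcases isEmpty_or_nonempty (Fin (finrank ℝ E)) with hemp | hne
  · have h0 : ‖T x‖ ^ 2 = 0 := by rw [hsq]; simp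
    rw [pow_eq_zero_iff two_ne_zero |>.1 h0]
    positivity
  obtain ⟨i0, hi0⟩ := Finite.exists_max fun i => |ev i|
  have hbound : ∀ y : E, ‖T y‖ ≤ |ev i0| * ‖y‖ := fun y => by
    refine (sq_le_sq₀ (by positivity) (by positivity)).1 ?_
    rw [mul_pow, hsq, hsq y, Finset.mul_sum]
    gcongr with i
    rw [hTc, mul_pow, ← sq_abs (ev i)]
    exact mul_le_mul_of_nonneg_right (pow_le_pow_left₀ (abs_nonneg _) (hi0 i) 2) (sq_nonneg _)
  have hmain : |ev i0| ≤ 2 * r := by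
    -- Compare the eigenvector of largest `|ev|` with a nearby net point `u = b i0 + y`. As both are
    -- unit vectors, `2 ⟪b i0, y⟫ = -‖y‖²`, so the error is of second order: `|ev i0| (1 - 2 ‖y‖²) ≤
    -- r` with `‖y‖² ≤ 1/4`.
    obtain ⟨u, hu, hux⟩ := hN (b i0) (b.norm_eq_one i0)
    have h1 := h u hu
    have hu1 := hN1 u hu
    set y := u - b i0 with hy
    have huy : u = b i0 + y := by rw [hy]; abel
    have hin : 2 * ⟪b i0, y⟫_ℝ = -‖y‖ ^ 2 := by
      have := norm_add_sq_real (b i0) y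
      rw [← huy, hu1, b.norm_eq_one] at this
      linarith
    have hexp : ⟪u, T u⟫_ℝ = ev i0 * (1 - ‖y‖ ^ 2) + ⟪y, T y⟫_ℝ := by
      rw [huy, map_add, inner_add_left, inner_add_right, inner_add_right, hTc, hTc, hb,
        real_inner_smul_right, real_inner_self_eq_norm_sq, b.norm_eq_one,
        real_inner_comm (b i0) y]
      have : ⟪b i0, y⟫_ℝ = -‖y‖ ^ 2 / 2 := by linarith
      rw [this]; ring
    have hyT : |⟪y, T y⟫_ℝ| ≤ |ev i0| * ‖y‖ ^ 2 := by
      calc _ ≤ ‖y‖ * ‖T y‖ := abs_real_inner_le_norm _ _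
        _ ≤ ‖y‖ * (|ev i0| * ‖y‖) := by gcongr; exact hbound y
        _ = _ := by ring
    have hy2 : ‖y‖ ^ 2 ≤ 1 / 4 := by nlinarith [norm_nonneg y]
    have h3 : |ev i0 * (1 - ‖y‖ ^ 2)| ≤ r + |ev i0| * ‖y‖ ^ 2 := by
      have : ev i0 * (1 - ‖y‖ ^ 2) = ⟪u, T u⟫_ℝ - ⟪y, T y⟫_ℝ := by linarith
      rw [this]
      exact (abs_sub _ _).trans (add_le_add h1 hyT)
    rw [abs_mul, abs_of_nonneg (by linarith : 0 ≤ 1 - ‖y‖ ^ 2)] at h3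
    nlinarith [abs_nonneg (ev i0)]
  exact (hbound x).trans (by gcongr)

theorem mem_span_subfamily_iff (b : OrthonormalBasis ι ℝ E) (p : ι → Prop) (x : E) :
    x ∈ Submodule.span ℝ {v | ∃ i, p i ∧ v = b i} ↔ ∀ i, ¬ p i → ⟪b i, x⟫_ℝ = 0 := by
  constructor
  · intro hx i hi
    induction hx using Submodule.span_induction with
    | mem y hy =>
      obtain ⟨j, hj, rfl⟩ := hy
      exact b.orthonormal.inner_eq_zero (fun h => hi (h ▸ hj))
    | zero => simp
    | add y z _ _ hy hz => rw [inner_add_right, hy, hz, add_zero]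
    | smul c y _ hy => rw [real_inner_smul_right, hy, mul_zero]
  · intro h
    rw [← b.sum_repr' x]
    refine Submodule.sum_mem _ fun i _ => ?_
    by_cases hi : p i
    · exact Submodule.smul_mem _ _ (Submodule.subset_span ⟨i, hi, rfl⟩)
    · rw [h i hi, zero_smul]; exact Submodule.zero_mem _

theorem finrank_span_subfamily (b : OrthonormalBasis ι ℝ E) (p : ι → Prop) [DecidablePred p] :
    finrank ℝ (Submodule.span ℝ {v | ∃ i, p i ∧ v = b i}) = Fintype.card {i // p i} := by
  have hs : {v | ∃ i, p i ∧ v = b i} = Set.range fun i : {i // p i} => b i := by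
    ext v; simp [eq_comm]
  rw [hs]
  exact finrank_span_eq_card
    (b.orthonormal.linearIndependent.comp _ Subtype.val_injective)

/-- Dimension count behind the Courant–Fischer type comparisons of eigenvalues. -/
theorem exists_ne_zero_mem_inf [FiniteDimensional ℝ E] {V W : Submodule ℝ E}
    (h : finrank ℝ E < finrank ℝ V + finrank ℝ W) : ∃ x : E, x ≠ 0 ∧ x ∈ V ∧ x ∈ W := by
  have h1 := Submodule.finrank_sup_add_finrank_inf_eq V W
  have h2 := Submodule.finrank_le (V ⊔ W)
  have h3 : V ⊓ W ≠ ⊥ := fun h' => by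
    rw [h', finrank_bot] at h1; omega
  obtain ⟨x, hx, hx0⟩ := Submodule.exists_mem_ne_zero_of_ne_bot h3
  exact ⟨x, hx0, hx.1, hx.2⟩

/-- A `sin θ` theorem of Davis–Kahan type: comparison of the range of a positive semidefinite
operator with the top eigenspace of a perturbation. -/
theorem norm_starProjection_sub_le [FiniteDimensional ℝ E] {d : ℕ} {A M : E →ₗ[ℝ] E}
    (b : OrthonormalBasis (Fin d) ℝ E)
    {ev : Fin d → ℝ} (hev : Antitone ev) (hb : ∀ i, A (b i) = ev i • b i)
    (hMpos : ∀ x, 0 ≤ ⟪M x, x⟫_ℝ) {Γ Γ' : Submodule ℝ E}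
    (hΓM : ∀ x ∈ Γᗮ, M x = 0) {lam : ℝ} (hlam : 0 < lam)
    (hlow : ∀ x ∈ Γ, lam * ‖x‖ ^ 2 ≤ ⟪M x, x⟫_ℝ) {k : ℕ} (hk : 1 ≤ k) (hΓ : finrank ℝ Γ = k)
    (hΓ' : Γ' = Submodule.span ℝ {v | ∃ i : Fin d, (i : ℕ) < k ∧ v = b i}) {ε : ℝ}
    (hε : ∀ x, ‖A x - M x‖ ≤ ε * ‖x‖) :
    ‖Γ'.starProjection - Γ.starProjection‖ ≤ 4 * ε / lam := by
  have hd : finrank ℝ E = d := by rw [finrank_eq_card_basis b.toBasis, Fintype.card_fin]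
  have hkd : k ≤ d := by rw [← hΓ, ← hd]; exact Submodule.finrank_le Γ
  have hε0 : 0 ≤ ε := by
    have := (norm_nonneg _).trans (hε (b ⟨0, by omega⟩))
    rwa [b.norm_eq_one, mul_one] at this
  have hsq : ∀ y : E, ‖y‖ ^ 2 = ∑ i, ⟪b i, y⟫_ℝ ^ 2 := fun y => by
    rw [← b.sum_sq_norm_inner_right y]; simp
  have hAc : ∀ (i) (y : E), ⟪b i, A y⟫_ℝ = ev i * ⟪b i, y⟫_ℝ := fun i y => by
    conv_lhs => rw [← b.sum_repr' y]
    simp only [map_sum, map_smul, hb, smul_smul, inner_sum, real_inner_smul_right]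
    rw [Finset.sum_eq_single i]
    · rw [real_inner_self_eq_norm_sq, b.norm_eq_one]; ring
    · intro j _ hj
      rw [b.orthonormal.inner_eq_zero hj.symm, mul_zero]
    · simp
  have hAq : ∀ y : E, ⟪A y, y⟫_ℝ = ∑ i, ev i * ⟪b i, y⟫_ℝ ^ 2 := fun y => by
    rw [← b.sum_inner_mul_inner (A y) y]
    refine Finset.sum_congr rfl fun i _ => ?_
    rw [real_inner_comm, hAc]; ring
  have hquad : ∀ y, |⟪A y, y⟫_ℝ - ⟪M y, y⟫_ℝ| ≤ ε * ‖y‖ ^ 2 := fun y => by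
    rw [← inner_sub_left]
    calc _ ≤ ‖A y - M y‖ * ‖y‖ := abs_real_inner_le_norm _ _
      _ ≤ ε * ‖y‖ * ‖y‖ := by gcongr; exact hε y
      _ = _ := by ring
  -- A large perturbation makes the right side at least 2, the trivial bound for two projections.
  by_cases hbig : lam / 2 ≤ ε
  · calc _ ≤ ‖Γ'.starProjection‖ + ‖Γ.starProjection‖ := norm_sub_le _ _
      _ ≤ 1 + 1 := add_le_add (Submodule.starProjection_norm_le _)
          (Submodule.starProjection_norm_le _)
      _ ≤ _ := by rw [le_div_iff₀ hlam]; linarith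
  push Not at hbig
  -- Weyl's inequality: Γ meets the span of the `b j` with `i ≤ j`, since `k + (d - i) > d`; there
  -- `A` is at most `ev i` but at least `lam - ε`.
  have hevtop : ∀ i : Fin d, (i : ℕ) < k → lam / 2 ≤ ev i := by
    intro i hi
    obtain ⟨x, hx0, hxΓ, hxW⟩ := exists_ne_zero_mem_inf (V := Γ)
      (W := Submodule.span ℝ {v | ∃ j : Fin d, i ≤ j ∧ v = b j}) (by
        rw [finrank_span_subfamily, hΓ, hd, Fintype.card_subtype]
        have : Finset.univ.filter (fun j : Fin d => i ≤ j) = Finset.Ici i := by ext; simp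
        rw [this, Fin.card_Ici]
        omega)
    rw [mem_span_subfamily_iff] at hxW
    have hxn : 0 < ‖x‖ ^ 2 := by have := norm_pos_iff.2 hx0; positivity
    have h1 : ⟪A x, x⟫_ℝ ≤ ev i * ‖x‖ ^ 2 := by
      rw [hAq, hsq, Finset.mul_sum]
      refine Finset.sum_le_sum fun j _ => ?_
      by_cases hj : i ≤ j
      · have := hev hj; gcongr
      · rw [hxW j hj]; simp
    have h2 := hlow x hxΓ
    have h3 := (abs_le.1 (hquad x)).1
    have : (lam - ε) * ‖x‖ ^ 2 ≤ ev i * ‖x‖ ^ 2 := by linarith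
    have := le_of_mul_le_mul_right this hxn
    linarith
  have hevbot : ∀ i : Fin d, k ≤ (i : ℕ) → |ev i| ≤ ε := by
    intro i hi
    rw [abs_le]
    constructor
    · have h1 := hquad (b i)
      rw [hb, real_inner_smul_left, real_inner_self_eq_norm_sq, b.norm_eq_one] at h1
      have h2 := hMpos (b i)
      have := (abs_le.1 h1).1
      linarith
    · obtain ⟨x, hx0, hxΓ, hxW⟩ := exists_ne_zero_mem_inf (V := Γᗮ)
        (W := Submodule.span ℝ {v | ∃ j : Fin d, j ≤ i ∧ v = b j}) (by
          have := Submodule.finrank_add_finrank_orthogonal Γ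
          rw [finrank_span_subfamily, hd, Fintype.card_subtype]
          have h2 : Finset.univ.filter (fun j : Fin d => j ≤ i) = Finset.Iic i := by ext; simp
          rw [h2, Fin.card_Iic]
          omega)
      rw [mem_span_subfamily_iff] at hxW
      have hxn : 0 < ‖x‖ ^ 2 := by have := norm_pos_iff.2 hx0; positivity
      have h1 : ev i * ‖x‖ ^ 2 ≤ ⟪A x, x⟫_ℝ := by
        rw [hAq, hsq, Finset.mul_sum]
        refine Finset.sum_le_sum fun j _ => ?_
        by_cases hj : j ≤ i
        · have := hev hj; gcongr
        · rw [hxW j hj]; simp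
      have h3 := (abs_le.1 (hquad x)).2
      rw [hΓM x hxΓ, inner_zero_left] at h3
      exact le_of_mul_le_mul_right (by linarith : ev i * ‖x‖ ^ 2 ≤ ε * ‖x‖ ^ 2) hxn
  have hΓ'mem : ∀ x, x ∈ Γ' ↔ ∀ i : Fin d, ¬ (i : ℕ) < k → ⟪b i, x⟫_ℝ = 0 := fun x => by
    rw [hΓ', mem_span_subfamily_iff]
  have hbmem : ∀ i : Fin d, (i : ℕ) < k → b i ∈ Γ' := fun i hi => by
    rw [hΓ']; exact Submodule.subset_span ⟨i, hi, rfl⟩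
  -- As `M v = 0`, `ev i * ⟪b i, v⟫ = ⟪b i, A v - M v⟫`, and `ev i ≥ lam / 2` for the top indices.
  have hpart1 : ∀ v ∈ Γᗮ, ‖Γ'.starProjection v‖ ≤ 2 * ε / lam * ‖v‖ := by
    intro v hv
    refine (sq_le_sq₀ (by positivity) (by positivity)).1 ?_
    calc ‖Γ'.starProjection v‖ ^ 2 = ∑ i, ⟪b i, Γ'.starProjection v⟫_ℝ ^ 2 := hsq _
      _ ≤ ∑ i, (2 / lam) ^ 2 * ⟪b i, A v - M v⟫_ℝ ^ 2 := by
          refine Finset.sum_le_sum fun i _ => ?_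
          by_cases hi : (i : ℕ) < k
          · have h1 : ⟪b i, Γ'.starProjection v⟫_ℝ = ⟪b i, v⟫_ℝ := by
              rw [← Submodule.inner_starProjection_left_eq_right,
                Submodule.starProjection_eq_self_iff.2 (hbmem i hi)]
            rw [h1, hΓM v hv, sub_zero, hAc, ← mul_pow]
            apply sq_le_sq.2
            have h2 := hevtop i hi
            have : 0 < ev i := by linarith
            rw [abs_mul, abs_mul, abs_of_pos (by positivity : 0 < 2 / lam), abs_of_pos this,
              ← mul_assoc]
            apply le_mul_of_one_le_left (abs_nonneg _)
            rw [div_mul_eq_mul_div, le_div_iff₀ hlam]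
            linarith
          · rw [(hΓ'mem _).1 (Submodule.starProjection_apply_mem _ v) i hi, zero_pow two_ne_zero]
            positivity
      _ = (2 / lam) ^ 2 * ‖A v - M v‖ ^ 2 := by rw [← Finset.mul_sum, ← hsq]
      _ ≤ (2 / lam) ^ 2 * (ε * ‖v‖) ^ 2 := by gcongr; exact hε v
      _ = _ := by ring
  -- Here `‖A v‖ ≤ ε ‖v‖`, so `‖M v‖ ≤ 2 ε ‖v‖`. Since `M` sees only the Γ-component `p` of `v`,
  -- coercivity of `M` on Γ bounds `p`.
  have hpart2 : ∀ v ∈ Γ'ᗮ, ‖Γ.starProjection v‖ ≤ 2 * ε / lam * ‖v‖ := by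
    intro v hv
    have hAv : ‖A v‖ ≤ ε * ‖v‖ := by
      refine (sq_le_sq₀ (by positivity) (by positivity)).1 ?_
      rw [mul_pow, hsq, hsq v, Finset.mul_sum]
      refine Finset.sum_le_sum fun i _ => ?_
      rw [hAc, mul_pow]
      by_cases hi : (i : ℕ) < k
      · rw [(Submodule.mem_orthogonal _ _).1 hv _ (hbmem i hi)]; simp
      · rw [← sq_abs (ev i)]
        have := hevbot i (by omega)
        gcongr
    have hMv : ‖M v‖ ≤ 2 * ε * ‖v‖ := by
      have h1 := norm_sub_le (A v) (A v - M v)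
      rw [sub_sub_cancel] at h1
      have := hε v
      linarith
    set p := Γ.starProjection v with hp
    have hpΓ : p ∈ Γ := Submodule.starProjection_apply_mem _ _
    have hMp : M p = M v := by
      have h1 := hΓM (v - p) (Submodule.sub_starProjection_mem_orthogonal v)
      rw [map_sub, sub_eq_zero] at h1
      exact h1.symm
    have h2 := hlow p hpΓ
    rw [hMp] at h2
    have h3 := real_inner_le_norm (M v) p
    have h4 : lam * ‖p‖ ^ 2 ≤ 2 * ε * ‖v‖ * ‖p‖ :=
      h2.trans (h3.trans (by gcongr))
    rw [div_mul_eq_mul_div, le_div_iff₀ hlam]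
    rcases (norm_nonneg p).eq_or_lt with h5 | h5
    · have : 0 ≤ 2 * ε * ‖v‖ := by positivity
      rw [← h5, zero_mul]; exact this
    · nlinarith
  have hop1 : ‖Γ'.starProjection ∘L (1 - Γ.starProjection)‖ ≤ 2 * ε / lam := by
    refine ContinuousLinearMap.opNorm_le_bound _ (by positivity) fun x => ?_
    have hx : ‖x - Γ.starProjection x‖ ≤ ‖x‖ := by
      rw [← Submodule.starProjection_orthogonal_val]
      exact Submodule.norm_starProjection_apply_le _ _
    calc _ ≤ _ := hpart1 (x - Γ.starProjection x) (Submodule.sub_starProjection_mem_orthogonal x)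
      _ ≤ _ := by gcongr
  have hop2 : ‖Γ.starProjection ∘L (1 - Γ'.starProjection)‖ ≤ 2 * ε / lam := by
    refine ContinuousLinearMap.opNorm_le_bound _ (by positivity) fun x => ?_
    have hx : ‖x - Γ'.starProjection x‖ ≤ ‖x‖ := by
      rw [← Submodule.starProjection_orthogonal_val]
      exact Submodule.norm_starProjection_apply_le _ _
    calc _ ≤ _ := hpart2 (x - Γ'.starProjection x) (Submodule.sub_starProjection_mem_orthogonal x)
      _ ≤ _ := by gcongr
  have hadj : ‖(1 - Γ'.starProjection) * Γ.starProjection‖ ≤ 2 * ε / lam := by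
    rw [← norm_star, star_mul, star_sub, star_one, (isSelfAdjoint_starProjection Γ).star_eq,
      (isSelfAdjoint_starProjection Γ').star_eq]
    exact hop2
  have hdecomp : Γ'.starProjection - Γ.starProjection =
      Γ'.starProjection * (1 - Γ.starProjection) -
        (1 - Γ'.starProjection) * Γ.starProjection := by
    noncomm_ring
  rw [hdecomp]
  calc _ ≤ _ := norm_sub_le _ _
    _ ≤ 2 * ε / lam + 2 * ε / lam := add_le_add hop1 hadj
    _ = _ := by ring

end UserPCA
end LinearAlgebra

/-! ### Quadratic forms of the matrices, concentration and the angle bound -/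

section Estimator

open Module
open scoped InnerProductSpace

namespace UserPCA

variable {n d : ℕ}

theorem toEuclideanLin_outer_apply (x y v : EuclideanSpace ℝ (Fin d)) :
    Matrix.toEuclideanLin (outer x y) v = ⟪y, v⟫_ℝ • x := by
  ext a
  simp [outer, Matrix.toLpLin_apply, Matrix.mulVec, dotProduct, PiLp.inner_apply, Finset.sum_mul]
  exact Finset.sum_congr rfl fun b _ => by ring

theorem meanMatrix_apply (w : Fin n → ℝ) (μ : Fin n → EuclideanSpace ℝ (Fin d))
    (v : EuclideanSpace ℝ (Fin d)) :
    Matrix.toEuclideanLin (meanMatrix w μ) v = ∑ i, (w i * ⟪μ i, v⟫_ℝ) • μ i := by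
  simp only [meanMatrix, map_sum, map_smul, LinearMap.sum_apply, LinearMap.smul_apply,
    toEuclideanLin_outer_apply, smul_smul]

theorem inner_meanMatrix_apply (w : Fin n → ℝ) (μ : Fin n → EuclideanSpace ℝ (Fin d))
    (v : EuclideanSpace ℝ (Fin d)) :
    ⟪Matrix.toEuclideanLin (meanMatrix w μ) v, v⟫_ℝ = ∑ i, w i * ⟪μ i, v⟫_ℝ ^ 2 := by
  rw [meanMatrix_apply, sum_inner]
  exact Finset.sum_congr rfl fun i _ => by rw [real_inner_smul_left]; ring

theorem estimatorMatrix_isHermitian (w : Fin n → ℝ) (m : Fin n → ℕ)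
    (x : (i : Fin n) → Fin (m i) → EuclideanSpace ℝ (Fin d)) :
    (estimatorMatrix w m x).IsHermitian := by
  ext a b
  simp only [estimatorMatrix, Matrix.conjTranspose_apply, Matrix.sum_apply, Matrix.smul_apply,
    star_trivial, smul_eq_mul]
  refine Finset.sum_congr rfl fun i _ => ?_
  rw [Finset.sum_comm]
  congr 1
  refine Finset.sum_congr rfl fun j₁ _ => Finset.sum_congr rfl fun j₂ _ => ?_
  by_cases h : j₁ = j₂
  · simp [h]
  · simp [h, Ne.symm h, outer, mul_comm]

theorem inner_estimatorMatrix_apply (w : Fin n → ℝ) (m : Fin n → ℕ)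
    (x : (i : Fin n) → Fin (m i) → EuclideanSpace ℝ (Fin d)) (u : EuclideanSpace ℝ (Fin d)) :
    ⟪u, Matrix.toEuclideanLin (estimatorMatrix w m x) u⟫_ℝ =
      ∑ i, w i * uStat fun j => ⟪u, x i j⟫_ℝ := by
  simp only [estimatorMatrix, map_sum, map_smul, LinearMap.sum_apply, LinearMap.smul_apply,
    inner_sum, real_inner_smul_right]
  refine Finset.sum_congr rfl fun i _ => ?_
  rw [uStat, ← sum_offDiag_mul, div_eq_mul_inv, mul_assoc]
  congr 2
  refine Finset.sum_congr rfl fun j₁ _ => Finset.sum_congr rfl fun j₂ _ => ?_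
  split_ifs
  · rw [toEuclideanLin_outer_apply, real_inner_smul_right, real_inner_comm u (x i j₂)]; ring
  · simp

theorem sigma_nonneg (w : Fin n → ℝ) (μ : Fin n → EuclideanSpace ℝ (Fin d)) (ℓ : ℕ) :
    0 ≤ sigma w μ ℓ := by
  unfold sigma
  split_ifs
  · exact Real.sqrt_nonneg _
  · exact le_rfl

/-- Spectral properties of `∑ i, wᵢ μᵢ μᵢᵀ`: its largest and its smallest nonzero eigenvalue. -/
theorem sigma_spec {w : Fin n → ℝ} (hw : ∀ i, 0 < w i) {μ : Fin n → EuclideanSpace ℝ (Fin d)}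
    {k : ℕ} (hk : 1 ≤ k) (hμ : finrank ℝ (Submodule.span ℝ (Set.range μ)) = k) :
    0 < sigma w μ k ∧
      (∀ x ∈ Submodule.span ℝ (Set.range μ), sigma w μ k ^ 2 * ‖x‖ ^ 2 ≤
        ⟪Matrix.toEuclideanLin (meanMatrix w μ) x, x⟫_ℝ) ∧
      ∀ x, ⟪Matrix.toEuclideanLin (meanMatrix w μ) x, x⟫_ℝ ≤ sigma w μ 1 ^ 2 * ‖x‖ ^ 2 := by
  have hkd : k ≤ d := by
    rw [← hμ]; simpa using Submodule.finrank_le (Submodule.span ℝ (Set.range μ))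
  set hH := meanMatrix_isHermitian w μ
  set T := Matrix.toEuclideanLin (meanMatrix w μ)
  have hT : T.IsSymmetric := Matrix.isSymmetric_toEuclideanLin_iff.mpr hH
  set b := hT.eigenvectorBasis finrank_euclideanSpace
  set ev := hH.eigenvalues₀ with hev
  have hb : ∀ i, T (b i) = ev i • b i := fun i => hT.apply_eigenvectorBasis finrank_euclideanSpace i
  have hanti : Antitone ev := hH.eigenvalues₀_antitone
  have hq : ∀ v, ⟪T v, v⟫_ℝ = ∑ i, w i * ⟪μ i, v⟫_ℝ ^ 2 := inner_meanMatrix_apply w μ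
  have hevq : ∀ i, ev i = ∑ l, w l * ⟪μ l, b i⟫_ℝ ^ 2 := fun i => by
    rw [← hq, hb, real_inner_smul_left, real_inner_self_eq_norm_sq, b.norm_eq_one]; ring
  have hev0 : ∀ i, 0 ≤ ev i := fun i => by
    rw [hevq]; exact Finset.sum_nonneg fun l _ => mul_nonneg (hw l).le (sq_nonneg _)
  have hsq : ∀ y : EuclideanSpace ℝ (Fin d), ‖y‖ ^ 2 = ∑ i, ⟪b i, y⟫_ℝ ^ 2 := fun y => by
    rw [← b.sum_sq_norm_inner_right y]; simp
  have hTq : ∀ y, ⟪T y, y⟫_ℝ = ∑ i, ev i * ⟪b i, y⟫_ℝ ^ 2 := fun y => by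
    rw [← b.sum_inner_mul_inner (T y) y]
    refine Finset.sum_congr rfl fun i _ => ?_
    rw [hT, hb, real_inner_smul_right, real_inner_comm]; ring
  -- An eigenvector with `ev i > 0` lies in the range of `T`, hence in the span of the means. If `ev
  -- i = 0`, positivity of the weights forces `b i` to be orthogonal to every mean. So exactly `k`
  -- eigenvalues are positive.
  have hspan : Submodule.span ℝ {v | ∃ i, 0 < ev i ∧ v = b i} =
      Submodule.span ℝ (Set.range μ) := by
    apply le_antisymm
    · rw [Submodule.span_le]
      rintro v ⟨i, hi, rfl⟩
      have h1 : b i = (ev i)⁻¹ • T (b i) := by rw [hb, smul_smul, inv_mul_cancel₀ hi.ne', one_smul]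
      rw [h1, SetLike.mem_coe, show T (b i) = _ from meanMatrix_apply w μ (b i)]
      exact Submodule.smul_mem _ _ (Submodule.sum_mem _ fun l _ =>
        Submodule.smul_mem _ _ (Submodule.subset_span ⟨l, rfl⟩))
    · rw [Submodule.span_le]
      rintro _ ⟨l, rfl⟩
      rw [SetLike.mem_coe, mem_span_subfamily_iff]
      intro i hi
      have h0 : ev i = 0 := le_antisymm (not_lt.1 hi) (hev0 i)
      rw [hevq, Finset.sum_eq_zero_iff_of_nonneg
        fun l _ => mul_nonneg (hw l).le (sq_nonneg _)] at h0
      have h1 := (mul_eq_zero.1 (h0 l (Finset.mem_univ l))).resolve_left (hw l).ne'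
      rw [real_inner_comm]
      exact (pow_eq_zero_iff two_ne_zero).1 h1
  have hcard : (Finset.univ.filter fun i => 0 < ev i).card = k := by
    classical
    rw [← hμ, ← hspan, finrank_span_subfamily, Fintype.card_subtype]
  have hlt : k - 1 < Fintype.card (Fin d) := by rw [Fintype.card_fin]; omega
  have h0lt : 0 < Fintype.card (Fin d) := by omega
  have hsk : sigma w μ k ^ 2 = ev ⟨k - 1, hlt⟩ := by
    rw [sigma, dif_pos ⟨hk, hkd⟩, Real.sq_sqrt (hev0 _)]
  have hs1 : sigma w μ 1 ^ 2 = ev ⟨0, h0lt⟩ := by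
    rw [sigma, dif_pos ⟨le_rfl, by omega⟩, Real.sq_sqrt (hev0 _)]
  have hidx : ∀ i, 0 < ev i → (i : ℕ) < k := fun i hi => by
    have : Finset.Iic i ⊆ Finset.univ.filter fun i => 0 < ev i := fun j hj => by
      simpa using hi.trans_le (hanti (Finset.mem_Iic.1 hj))
    have := Finset.card_le_card this
    rw [hcard, Fin.card_Iic] at this
    omega
  have hpos : 0 < ev ⟨k - 1, hlt⟩ := by
    by_contra hcon
    have : (Finset.univ.filter fun i => 0 < ev i) ⊆ Finset.Iio ⟨k - 1, hlt⟩ := fun j hj => by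
      rw [Finset.mem_Iio]
      by_contra hj2
      exact hcon ((Finset.mem_filter.1 hj).2.trans_le (hanti (not_lt.1 hj2)))
    have := Finset.card_le_card this
    rw [hcard, Fin.card_Iio] at this
    simp at this
    omega
  refine ⟨?_, ?_, ?_⟩
  · refine (sigma_nonneg w μ k).lt_of_ne fun h => ?_
    rw [← hsk, ← h] at hpos
    norm_num at hpos
  · intro x hx
    rw [← hspan, mem_span_subfamily_iff] at hx
    rw [hsk, hTq, hsq, Finset.mul_sum]
    refine Finset.sum_le_sum fun i _ => ?_
    by_cases hi : 0 < ev i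
    · have h1 := hidx i hi
      have h2 : i ≤ ⟨k - 1, hlt⟩ := by rw [Fin.le_def]; simp; omega
      exact mul_le_mul_of_nonneg_right (hanti h2) (sq_nonneg _)
    · rw [hx i hi]; simp
  · intro x
    rw [hs1, hTq, hsq, Finset.mul_sum]
    refine Finset.sum_le_sum fun i _ => ?_
    have h2 : (⟨0, h0lt⟩ : Fin (Fintype.card (Fin d))) ≤ i := by rw [Fin.le_def]; simp
    exact mul_le_mul_of_nonneg_right (hanti h2) (sq_nonneg _)

variable {Ω : Type*} [MeasurableSpace Ω] {P : Measure Ω}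

/-- Integrability is what lets the vanishing vector mean pass to the marginals. -/
theorem IsSubGaussianVector.integrable {y : Ω → EuclideanSpace ℝ (Fin d)} {b : ℝ}
    (h : IsSubGaussianVector P y b) : Integrable y P := by
  have hrep : y = fun ω => ∑ i, ⟪EuclideanSpace.basisFun (Fin d) ℝ i, y ω⟫_ℝ •
      EuclideanSpace.basisFun (Fin d) ℝ i := by
    ext1 ω
    rw [(EuclideanSpace.basisFun (Fin d) ℝ).sum_repr']
  rw [hrep]
  exact integrable_finsetSum _ fun i _ =>
    (h _ ((EuclideanSpace.basisFun (Fin d) ℝ).norm_eq_one i)).1.smul_const _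

/-- The rate 3 in the tails is chosen for this: `5 e⁻³ ≤ 1/4` absorbs both the size of the net and
the factor 4. -/
theorem union_bound_numeric {d : ℕ} (hd : 1 ≤ d) {δ : ℝ} (hδ0 : 0 < δ) (hδ : δ < 1 / 2) :
    (5 : ℝ) ^ d * (4 * Real.exp (-(3 * (d + Real.log (1 / δ))))) ≤ δ := by
  have h1 : Real.exp (-(3 * (d + Real.log (1 / δ)))) = Real.exp (-3) ^ d * δ ^ 3 := by
    have : -(3 * ((d : ℝ) + Real.log (1 / δ))) = d * (-3) + (3 : ℕ) * Real.log δ := by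
      rw [one_div, Real.log_inv]; push_cast; ring
    rw [this, Real.exp_add, Real.exp_nat_mul, Real.exp_nat_mul, Real.exp_log hδ0]
  have h2 : 5 * Real.exp (-3) ≤ 1 / 4 := by
    have h3 : (20 : ℝ) ≤ Real.exp 3 := by
      have := Real.exp_one_gt_d9
      have h4 : Real.exp 3 = Real.exp 1 ^ 3 := by rw [← Real.exp_nat_mul]; norm_num
      rw [h4]
      calc (20 : ℝ) ≤ 2.7182818283 ^ 3 := by norm_num
        _ ≤ _ := by gcongr
    rw [Real.exp_neg]
    have : (Real.exp 3)⁻¹ ≤ (20 : ℝ)⁻¹ := inv_anti₀ (by norm_num) h3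
    linarith
  have h3 : (5 * Real.exp (-3)) ^ d ≤ 1 / 4 :=
    (pow_le_of_le_one (by positivity) (by linarith) (by omega)).trans h2
  rw [h1]
  calc (5 : ℝ) ^ d * (4 * (Real.exp (-3) ^ d * δ ^ 3))
      = 4 * (5 * Real.exp (-3)) ^ d * δ ^ 3 := by rw [mul_pow]; ring
    _ ≤ 4 * (1 / 4) * δ ^ 3 := by gcongr
    _ ≤ δ := by
      have : δ ^ 3 ≤ δ := pow_le_of_le_one hδ0.le (by linarith) (by norm_num)
      linarith

theorem sin_maxPrincipalAngle_le (V W : Submodule ℝ (EuclideanSpace ℝ (Fin d))) :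
    Real.sin (maxPrincipalAngle V W) ≤ ‖V.starProjection - W.starProjection‖ := by
  rw [maxPrincipalAngle]
  set y := ‖V.starProjection - W.starProjection‖
  have hy : 0 ≤ y := norm_nonneg _
  rcases le_total y 1 with h | h
  · rw [Real.sin_arcsin (by linarith) h]
  · exact (Real.sin_le_one _).trans h

/-- With high probability the estimator is close to its mean in operator norm. -/
theorem estimator_concentration [IsProbabilityMeasure P] {k : ℕ} (hn : 0 < n) (hk : 1 ≤ k)
    {μ : Fin n → EuclideanSpace ℝ (Fin d)}
    (hμ : finrank ℝ (Submodule.span ℝ (Set.range μ)) = k)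
    {m : Fin n → ℕ} (hm : ∀ i, 2 ≤ m i) {η : Fin n → ℝ} (hη : ∀ i, 0 ≤ η i)
    {z : (i : Fin n) → Fin (m i) → Ω → EuclideanSpace ℝ (Fin d)}
    (hz : ∀ i j, Measurable (z i j))
    (hind : iIndepFun (fun (p : (i : Fin n) × Fin (m i)) => z p.1 p.2) P)
    (h0 : ∀ i j, ∫ ω, z i j ω ∂P = 0) (hsub : ∀ i j, IsSubGaussianVector P (z i j) (η i))
    {w : Fin n → ℝ} (hw : ∀ i, w i = 1 / (n : ℝ)) {t : ℝ} (ht0 : 0 ≤ t)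
    (ht : ∀ i, η i ^ 2 / m i ≤ t ^ 2) (hσ : 0 < sigma w μ 1)
    {δ : ℝ} (hδ0 : 0 < δ) (hδ : δ < 1 / 2) {s : ℝ} (hs : 0 < s)
    (hns : n * s ^ 2 = d + Real.log (1 / δ)) :
    WithProbAtLeast P (1 - δ) fun ω => ∀ v : EuclideanSpace ℝ (Fin d),
      ‖Matrix.toEuclideanLin (estimatorMatrix w m fun i j => μ i + z i j ω) v -
        Matrix.toEuclideanLin (meanMatrix w μ) v‖ ≤
      2 * (27 * (t * sigma w μ 1 * s) + 5040 * t ^ 2 * (s + s ^ 2)) * ‖v‖ := by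
  have hn0 : (0 : ℝ) < n := by exact_mod_cast hn
  have hw0 : ∀ i, 0 < w i := fun i => by rw [hw]; positivity
  have hd : 1 ≤ d := by
    have := Submodule.finrank_le (Submodule.span ℝ (Set.range μ))
    rw [hμ, finrank_euclideanSpace_fin] at this
    omega
  obtain ⟨-, -, hup⟩ := sigma_spec hw0 hk hμ
  set σ := sigma w μ 1
  set r := 27 * (t * σ * s) + 5040 * t ^ 2 * (s + s ^ 2) with hr
  obtain ⟨N, hNc, hN1, hN⟩ := exists_half_net (EuclideanSpace ℝ (Fin d))
  rw [finrank_euclideanSpace_fin] at hNc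
  -- The quadratic form of the estimation error in direction `u`.
  let f : EuclideanSpace ℝ (Fin d) → Ω → ℝ := fun u ω =>
    ∑ i, 1 / (n : ℝ) * (uStat (fun j => ⟪u, μ i⟫_ℝ + ⟪u, z i j ω⟫_ℝ) - ⟪u, μ i⟫_ℝ ^ 2)
  have hfm : ∀ u, Measurable (f u) := fun u => by
    unfold f uStat
    fun_prop
  have htail : ∀ u ∈ N, P.real {ω | r < |f u ω|} ≤ 4 * Real.exp (-(3 * (n * s ^ 2))) := by
    intro u hu
    have hu1 := hN1 u hu
    refine direction_tail hn hm hη ht0 ht hσ hs ?_ (fun i j => by fun_prop)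
      (hind.comp (fun _ x => ⟪u, x⟫_ℝ) fun _ => by fun_prop) (fun i j => hsub i j u hu1) ?_
    · have h1 := hup u
      rw [inner_meanMatrix_apply, hu1] at h1
      simp only [hw, ← Finset.mul_sum] at h1
      rw [one_div, inv_mul_le_iff₀ hn0] at h1
      simpa only [fun i => real_inner_comm u (μ i), one_pow, mul_one] using h1
    · intro i j
      rw [integral_inner (hsub i j).integrable, h0, inner_zero_right]
  refine ⟨⋂ u ∈ N, {ω | |f u ω| ≤ r}, ?_, ?_, ?_⟩
  · exact Finset.measurableSet_biInter _ fun u _ =>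
      measurableSet_le (hfm u).norm measurable_const
  · have hmeas : MeasurableSet (⋂ u ∈ N, {ω | |f u ω| ≤ r}) :=
      Finset.measurableSet_biInter _ fun u _ => measurableSet_le (hfm u).norm measurable_const
    have hc : P.real (⋂ u ∈ N, {ω | |f u ω| ≤ r})ᶜ ≤ δ := by
      have hset : (⋂ u ∈ N, {ω | |f u ω| ≤ r})ᶜ = ⋃ u ∈ N, {ω | r < |f u ω|} := by
        ext ω; simp
      rw [hset]
      calc _ ≤ ∑ u ∈ N, P.real {ω | r < |f u ω|} := measureReal_biUnion_finset_le _ _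
        _ ≤ ∑ _u ∈ N, 4 * Real.exp (-(3 * (n * s ^ 2))) := Finset.sum_le_sum htail
        _ = N.card * (4 * Real.exp (-(3 * (n * s ^ 2)))) := by simp
        _ ≤ (5 : ℝ) ^ d * (4 * Real.exp (-(3 * (n * s ^ 2)))) := by
            gcongr
            exact_mod_cast hNc
        _ ≤ δ := by rw [hns]; exact union_bound_numeric hd hδ0 hδ
    rw [probReal_compl_eq_one_sub hmeas] at hc
    rw [← ofReal_measureReal]
    exact ENNReal.ofReal_le_ofReal (by linarith)
  · intro ω hω v
    simp only [Set.mem_iInter, Set.mem_ofPred_eq] at hω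
    rw [← LinearMap.sub_apply]
    refine norm_apply_le_of_half_net ?_ hN1 hN (by positivity) (fun u hu => ?_) v
    · exact (Matrix.isSymmetric_toEuclideanLin_iff.mpr (estimatorMatrix_isHermitian _ _ _)).sub
        (Matrix.isSymmetric_toEuclideanLin_iff.mpr (meanMatrix_isHermitian _ _))
    · convert! hω u hu using 2
      rw [LinearMap.sub_apply, inner_sub_right, inner_estimatorMatrix_apply,
        real_inner_comm _ u, inner_meanMatrix_apply, ← Finset.sum_sub_distrib]
      refine Finset.sum_congr rfl fun i _ => ?_
      simp only [inner_add_right]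
      rw [hw, real_inner_comm u (μ i)]; ring

/-- The `sin θ` bound with an explicit constant. -/
theorem sin_maxPrincipalAngle_concentration [IsProbabilityMeasure P] {k : ℕ} (hn : 0 < n)
    (hk : 1 ≤ k) {μ : Fin n → EuclideanSpace ℝ (Fin d)}
    (hμ : finrank ℝ (Submodule.span ℝ (Set.range μ)) = k)
    {m : Fin n → ℕ} (hm : ∀ i, 2 ≤ m i) {η : Fin n → ℝ} (hη : ∀ i, 0 ≤ η i)
    {z : (i : Fin n) → Fin (m i) → Ω → EuclideanSpace ℝ (Fin d)}
    (hz : ∀ i j, Measurable (z i j))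
    (hind : iIndepFun (fun (p : (i : Fin n) × Fin (m i)) => z p.1 p.2) P)
    (h0 : ∀ i j, ∫ ω, z i j ω ∂P = 0) (hsub : ∀ i j, IsSubGaussianVector P (z i j) (η i))
    {w : Fin n → ℝ} (hw : ∀ i, w i = 1 / (n : ℝ)) {t : ℝ} (ht0 : 0 ≤ t)
    (ht : ∀ i, η i ^ 2 / m i ≤ t ^ 2) {δ : ℝ} (hδ0 : 0 < δ) (hδ : δ < 1 / 2) :
    WithProbAtLeast P (1 - δ) fun ω => ∀ Γhat : Submodule ℝ (EuclideanSpace ℝ (Fin d)),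
      IsTopEigenspace (estimatorMatrix w m fun i j => μ i + z i j ω) k Γhat →
        Real.sin (maxPrincipalAngle Γhat (Submodule.span ℝ (Set.range μ))) ≤
          40536 * ((t * sigma w μ 1 + t ^ 2) / sigma w μ k ^ 2 *
            √(((d : ℝ) + Real.log (1 / δ)) / (n : ℝ))) := by
  have hn0 : (0 : ℝ) < n := by exact_mod_cast hn
  have hw0 : ∀ i, 0 < w i := fun i => by rw [hw]; positivity
  obtain ⟨hσk, hlow, hup⟩ := sigma_spec hw0 hk hμ
  have hσk2 : 0 < sigma w μ k ^ 2 := by positivity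
  have hσσ : sigma w μ k ^ 2 ≤ sigma w μ 1 ^ 2 := by
    have hne : Submodule.span ℝ (Set.range μ) ≠ ⊥ := fun h => by
      rw [h, finrank_bot] at hμ; omega
    obtain ⟨x, hx, hx0⟩ := Submodule.exists_mem_ne_zero_of_ne_bot hne
    have hxn : 0 < ‖x‖ ^ 2 := by have := norm_pos_iff.2 hx0; positivity
    exact le_of_mul_le_mul_right ((hlow x hx).trans (hup x)) hxn
  have hσ : 0 < sigma w μ 1 := by
    refine (sigma_nonneg w μ 1).lt_of_ne fun h => ?_
    rw [← h] at hσσ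
    norm_num at hσσ
    linarith
  have hlog : 0 < Real.log (1 / δ) := Real.log_pos (by rw [lt_div_iff₀ hδ0]; linarith)
  set s := √(((d : ℝ) + Real.log (1 / δ)) / (n : ℝ)) with hs
  have hs0 : 0 < s := by positivity
  have hns : n * s ^ 2 = d + Real.log (1 / δ) := by
    rw [hs, Real.sq_sqrt (by positivity)]; field_simp
  obtain ⟨ev, hE, hPE, h⟩ :=
    estimator_concentration hn hk hμ hm hη hz hind h0 hsub hw ht0 ht hσ hδ0 hδ hs0 hns
  refine ⟨ev, hE, hPE, fun ω hω Γhat ⟨b, l, hl, hb, hΓ⟩ => ?_⟩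
  set σ := sigma w μ 1
  -- If `σ ≤ t s`, then `σ_k² ≤ σ² ≤ t σ s` and the right side exceeds 1. Otherwise `t² s² ≤ t σ s`,
  -- and the coefficient of `t σ s` becomes `4 * 2 * (27 + 5040) = 40536`.
  rcases le_or_gt σ (t * s) with hbig | hsmall
  · refine (Real.sin_le_one _).trans ?_
    have h1 : sigma w μ k ^ 2 ≤ (t * σ + t ^ 2) * s := by
      nlinarith [mul_nonneg (sq_nonneg t) hs0.le]
    rw [div_mul_eq_mul_div]
    have : 1 ≤ (t * σ + t ^ 2) * s / sigma w μ k ^ 2 := by rwa [one_le_div hσk2]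
    linarith
  · refine (sin_maxPrincipalAngle_le _ _).trans ?_
    have hker : ∀ x ∈ (Submodule.span ℝ (Set.range μ))ᗮ,
        Matrix.toEuclideanLin (meanMatrix w μ) x = 0 := fun x hx => by
      rw [meanMatrix_apply]
      refine Finset.sum_eq_zero fun i _ => ?_
      rw [(Submodule.mem_orthogonal _ _).1 hx _ (Submodule.subset_span ⟨i, rfl⟩)]
      simp
    have hpos : ∀ x, 0 ≤ ⟪Matrix.toEuclideanLin (meanMatrix w μ) x, x⟫_ℝ := fun x => by
      rw [inner_meanMatrix_apply]
      exact Finset.sum_nonneg fun i _ => mul_nonneg (hw0 i).le (sq_nonneg _)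
    refine (norm_starProjection_sub_le b hl hb hpos hker hσk2 hlow hk hμ hΓ (h ω hω)).trans ?_
    rw [div_mul_eq_mul_div, ← mul_div_assoc, div_le_div_iff_of_pos_right hσk2]
    have : t ^ 2 * s ^ 2 ≤ t * σ * s := by nlinarith [mul_nonneg ht0 hs0.le]
    nlinarith [mul_nonneg (sq_nonneg t) hs0.le]

end UserPCA
end Estimator

theorem corollary3p2 :
    ∃ C : ℝ, 0 < C ∧
      ∀ {Ω : Type*} [MeasurableSpace Ω] (P : Measure Ω) [IsProbabilityMeasure P]
        (n d k : ℕ) (_hk : 1 ≤ k)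
        (μ : Fin n → EuclideanSpace ℝ (Fin d))
        (_hμ : Module.finrank ℝ (Submodule.span ℝ (Set.range μ)) = k)
        (m : Fin n → ℕ) (_hm : ∀ i, 2 ≤ m i)
        (η : Fin n → ℝ) (_hη : ∀ i, 0 ≤ η i)
        (z : (i : Fin n) → Fin (m i) → Ω → EuclideanSpace ℝ (Fin d))
        (_hz_meas : ∀ i j, Measurable (z i j))
        (_hz_indep : iIndepFun (fun (p : (i : Fin n) × Fin (m i)) => z p.1 p.2) P)
        (_hz_mean : ∀ i j, ∫ ω, z i j ω ∂P = 0)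
        (_hz_subG : ∀ i j, UserPCA.IsSubGaussianVector P (z i j) (η i))
        (w : Fin n → ℝ) (_hw : ∀ i, w i = 1 / (n : ℝ))
        (t : ℝ) (_ht : IsGreatest (Set.range fun i => η i / √(m i : ℝ)) t)
        (δ : ℝ) (_hδ0 : 0 < δ) (_hδ : δ < 1 / 2),
        UserPCA.WithProbAtLeast P (1 - δ) (fun ω =>
          ∀ Γhat : Submodule ℝ (EuclideanSpace ℝ (Fin d)),
            UserPCA.IsTopEigenspace
                (UserPCA.estimatorMatrix w m (fun i j => μ i + z i j ω)) k Γhat →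
              Real.sin (UserPCA.maxPrincipalAngle Γhat (Submodule.span ℝ (Set.range μ))) ≤
                C * ((t * UserPCA.sigma w μ 1 + t ^ 2) / UserPCA.sigma w μ k ^ 2 *
                  √(((d : ℝ) + Real.log (1 / δ)) / (n : ℝ)))) ∧
        ∀ (η₀ : ℝ) (m₀ : ℕ), (∀ i, η i = η₀) → (∀ i, m i = m₀) →
          UserPCA.WithProbAtLeast P (1 - δ) (fun ω =>
            ∀ Γhat : Submodule ℝ (EuclideanSpace ℝ (Fin d)),
              UserPCA.IsTopEigenspace
                  (UserPCA.estimatorMatrix w m (fun i j => μ i + z i j ω)) k Γhat →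
                Real.sin (UserPCA.maxPrincipalAngle Γhat (Submodule.span ℝ (Set.range μ))) ≤
                  C * ((η₀ * UserPCA.sigma w μ 1 / (UserPCA.sigma w μ k ^ 2 * √(m₀ : ℝ)) +
                      η₀ ^ 2 / (UserPCA.sigma w μ k ^ 2 * (m₀ : ℝ))) *
                    √(((d : ℝ) + Real.log (1 / δ)) / (n : ℝ)))) := by
  refine ⟨40536, by norm_num, ?_⟩
  intro Ω _ P _ n d k hk μ hμ m hm η hη z hz hind h0 hsub w hw t ht δ hδ0 hδ
  obtain ⟨⟨i₀, hi₀⟩, htub⟩ := ht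
  -- The maximum `t` is attained, so the index set is nonempty.
  have hn : 0 < n := i₀.pos
  have hm0 : ∀ i, (0 : ℝ) < m i := fun i => by
    exact_mod_cast (by have := hm i; omega : 0 < m i)
  have ht0 : 0 ≤ t := by
    rw [← hi₀]
    exact div_nonneg (hη i₀) (Real.sqrt_nonneg _)
  have ht2 : ∀ i, η i ^ 2 / m i ≤ t ^ 2 := fun i => by
    rw [← Real.sq_sqrt (hm0 i).le, ← div_pow]
    exact pow_le_pow_left₀ (div_nonneg (hη i) (Real.sqrt_nonneg _)) (htub ⟨i, rfl⟩) 2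
  have hmain := UserPCA.sin_maxPrincipalAngle_concentration hn hk hμ hm hη hz hind h0 hsub hw ht0
    ht2 hδ0 hδ
  refine ⟨hmain, fun η₀ m₀ hη₀ hm₀ => ?_⟩
  have hteq : t = η₀ / √(m₀ : ℝ) := by rw [← hi₀, ← hη₀ i₀, ← hm₀ i₀]
  have hm₀pos : (0 : ℝ) < m₀ := by rw [← hm₀ i₀]; exact hm0 i₀
  have hsq : √(m₀ : ℝ) ^ 2 = m₀ := Real.sq_sqrt hm₀pos.le
  have hrhs : (t * UserPCA.sigma w μ 1 + t ^ 2) / UserPCA.sigma w μ k ^ 2 =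
      η₀ * UserPCA.sigma w μ 1 / (UserPCA.sigma w μ k ^ 2 * √(m₀ : ℝ)) +
        η₀ ^ 2 / (UserPCA.sigma w μ k ^ 2 * (m₀ : ℝ)) := by
    rw [hteq, add_div, div_pow, hsq]
    congr 1
    · rw [div_mul_eq_mul_div, div_div, mul_comm (√(m₀ : ℝ))]
    · rw [div_div, mul_comm (m₀ : ℝ)]
  rwa [hrhs] at hmain
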